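/- Let $G$ be a topological group whose underlying space is contractible, and let $V$ be a topological $G$-module, i.e. an abelian topological group with an additive $G$-action for which $G\times V\to V$ is continuous. For $n\ge 0$ let $A^n(G;V)^G$ be the group of all (not necessarily continuous) maps $f:G^{n+1}\to V$ with $f(gx_0,\dots,gx_n)=g.f(x_0,\dots,x_n)$, with differential $$(df)(x_0,\dots,x_{n+1})=\sum_{i=0}^{n+1}(-1)^i f(x_0,\dots,\widehat{x_i},\dots,x_{n+1}).$$ Let $A_c^*(G;V)^G$ be the subcomplex of continuous such maps; its cohomology is the continuous group cohomology $H_c^*(G;V)$. Let $A_{cg}^*(G;V)^G$ be the subcomplex of those $f\in A^n(G;V)^G$ whose germ at the diagonal is continuous, i.e. for which there is an open covering $\mathfrak U$ of $G$ such that the restriction of $f$ to $\bigcup_{U\in\mathfrak U}U^{n+1}$ is continuous. Then the inclusion of cochain complexes $A_c^*(G;V)^G\hookrightarrow A_{cg}^*(G;V)^G$ induces an isomorphism in cohomology in every degree $n\ge 0$; in particular $H_c^n(G;V)\cong H^n\big(A_{cg}^*(G;V)^G\big)$. -/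

import Mathlib

open CategoryTheory

universe u v w

namespace EqCoh

section Standard

variable (X : Type u) (V : Type v) [AddCommGroup V]

/-- The group `A^n (X;V)` of all functions `X^{n+1} → V`. -/
abbrev Cochain (n : ℕ) : Type (max u v) := (Fin (n + 1) → X) → V

/-- The differential of the standard complex,
`(d f) (x_0, …, x_{n+1}) = ∑ i, (-1)^i f (x_0, …, x_{i-1}, x_{i+1}, …, x_{n+1})`. -/
def d (n : ℕ) : Cochain X V n →+ Cochain X V (n + 1) where
  toFun f := fun x => ∑ i : Fin (n + 2), (-1 : ℤ) ^ (i : ℕ) • f (fun j => x (i.succAbove j))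
  map_zero' := by ext x; simp
  map_add' f g := by ext x; simp [Finset.sum_add_distrib]

theorem d_apply (n : ℕ) (f : Cochain X V n) (x : Fin (n + 2) → X) :
    d X V n f x = ∑ i : Fin (n + 2), (-1 : ℤ) ^ (i : ℕ) • f (fun j => x (i.succAbove j)) := rfl

theorem d_d (n : ℕ) (f : Cochain X V n) : d X V (n + 1) (d X V n f) = 0 := by
  ext x
  simp only [d_apply, Finset.smul_sum, smul_smul, Pi.zero_apply]
  rw [← Finset.sum_product', Finset.univ_product_univ]
  refine Finset.sum_involution (fun p _ => (p.1.succAbove p.2, p.2.predAbove p.1)) ?_ ?_ ?_ ?_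
  · rintro ⟨i, j⟩ -
    rw [← pow_add, ← pow_add, Fin.neg_one_pow_succAbove_add_predAbove]
    simp only [Fin.succAbove_succAbove_succAbove_predAbove]
    simp
  · rintro ⟨i, j⟩ - - h
    exact Fin.succAbove_ne i j (congrArg Prod.fst h)
  · simp
  · rintro ⟨i, j⟩ -
    simp only [Fin.succAbove_succAbove_predAbove, Fin.predAbove_predAbove_succAbove]

end Standard

/-- The cochain complex formed by a family of subgroups `S n` of `A^n (X;V)` which is stable
under the differential of the standard complex, with the restricted differential. -/
noncomputable def subcomplex {X : Type u} {V : Type v} [AddCommGroup V]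
    (S : ∀ n, AddSubgroup (Cochain X V n))
    (hS : ∀ n, ∀ f ∈ S n, d X V n f ∈ S (n + 1)) :
    CochainComplex AddCommGrpCat.{max u v} ℕ :=
  CochainComplex.of (fun n => AddCommGrpCat.of (S n))
    (fun n => AddCommGrpCat.ofHom
      (((d X V n).comp (S n).subtype).codRestrict (S (n + 1)) (fun f => hS n f.1 f.2)))
    (fun n => AddCommGrpCat.hom_ext
      (AddMonoidHom.ext fun f => Subtype.ext (d_d X V n f.1)))

/-- The inclusion of one such complex into a larger one. -/
noncomputable def subcomplexInclusion {X : Type u} {V : Type v} [AddCommGroup V]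
    {S T : ∀ n, AddSubgroup (Cochain X V n)}
    (hS : ∀ n, ∀ f ∈ S n, d X V n f ∈ S (n + 1))
    (hT : ∀ n, ∀ f ∈ T n, d X V n f ∈ T (n + 1))
    (hST : ∀ n, S n ≤ T n) : subcomplex S hS ⟶ subcomplex T hT :=
  CochainComplex.ofHom
    (fun n => AddCommGrpCat.ofHom (AddSubgroup.inclusion (hST n)))
    (fun n => by
      simp only [subcomplex, CochainComplex.of_d]
      rfl)

/-- The subset `𝔘[n] = ⋃ U ∈ 𝔘, U^{n+1}` of `X^{n+1}`. -/
def diagNhd {X : Type u} (𝔘 : Set (Set X)) (n : ℕ) : Set (Fin (n + 1) → X) :=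
  ⋃ U ∈ 𝔘, {x | ∀ i, x i ∈ U}

/-- `𝔘` is an open covering of `X`. -/
def IsOpenCovering {X : Type u} [TopologicalSpace X] (𝔘 : Set (Set X)) : Prop :=
  (∀ U ∈ 𝔘, IsOpen U) ∧ ⋃₀ 𝔘 = Set.univ

section Groups

variable (G : Type w) (X : Type u) (V : Type v) [Group G] [MulAction G X]
  [AddCommGroup V] [DistribMulAction G V]

/-- The group `A^n (X;V)^G` of equivariant cochains (`G` acts diagonally on `X^{n+1}`). -/
def eqCochains (n : ℕ) : AddSubgroup (Cochain X V n) where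
  carrier := {f | ∀ (g : G) (x : Fin (n + 1) → X), f (fun i => g • x i) = g • f x}
  zero_mem' := fun g x => by simp
  add_mem' := fun {a b} ha hb g x => by simp [ha g x, hb g x]
  neg_mem' := fun {a} ha g x => by simp [ha g x]

variable {G X V} in
theorem d_mem_eqCochains (n : ℕ) (f : Cochain X V n) (hf : f ∈ eqCochains G X V n) :
    d X V n f ∈ eqCochains G X V (n + 1) := by
  intro g x
  simp only [d_apply, Finset.smul_sum]
  refine Finset.sum_congr rfl fun i _ => ?_
  rw [hf g (fun j => x (i.succAbove j)), smul_comm]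

variable [TopologicalSpace X] [TopologicalSpace V] [IsTopologicalAddGroup V]

/-- The group `A_c^n (X;V)` of continuous cochains. -/
def contCochains (n : ℕ) : AddSubgroup (Cochain X V n) where
  carrier := {f | Continuous f}
  zero_mem' := continuous_zero
  add_mem' := fun ha hb => Continuous.add ha hb
  neg_mem' := fun ha => Continuous.neg ha

/-- The group `A_{cg}^n (X;V)` of (globally defined) cochains with continuous germ at the diagonal:
those whose restriction to `𝔘[n]` is continuous for some open covering `𝔘` of `X`. -/
def germCochains (n : ℕ) : AddSubgroup (Cochain X V n) where
  carrier := {f | ∃ 𝔘 : Set (Set X), IsOpenCovering 𝔘 ∧ ContinuousOn f (diagNhd 𝔘 n)}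
  zero_mem' := ⟨{Set.univ}, ⟨by simp, by simp⟩, continuousOn_const⟩
  add_mem' := by
    rintro a b ⟨𝔘, hU, ha⟩ ⟨𝔚, hW, hb⟩
    refine ⟨Set.image2 (· ∩ ·) 𝔘 𝔚, ⟨?_, ?_⟩, ?_⟩
    · rintro _ ⟨U, hU', W, hW', rfl⟩
      exact (hU.1 U hU').inter (hW.1 W hW')
    · refine Set.eq_univ_of_forall fun x => ?_
      obtain ⟨U, hU', hxU⟩ := Set.mem_sUnion.1 (hU.2.symm ▸ Set.mem_univ x)
      obtain ⟨W, hW', hxW⟩ := Set.mem_sUnion.1 (hW.2.symm ▸ Set.mem_univ x)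
      exact ⟨U ∩ W, ⟨U, hU', W, hW', rfl⟩, hxU, hxW⟩
    · refine ContinuousOn.add (ha.mono ?_) (hb.mono ?_)
      · intro x hx
        simp only [diagNhd, Set.mem_iUnion, Set.mem_ofPred_eq] at hx ⊢
        obtain ⟨_, ⟨U, hU', W, hW', rfl⟩, hx⟩ := hx
        exact ⟨U, hU', fun i => (hx i).1⟩
      · intro x hx
        simp only [diagNhd, Set.mem_iUnion, Set.mem_ofPred_eq] at hx ⊢
        obtain ⟨_, ⟨U, hU', W, hW', rfl⟩, hx⟩ := hx
        exact ⟨W, hW', fun i => (hx i).2⟩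
  neg_mem' := by
    rintro a ⟨𝔘, hU, ha⟩
    exact ⟨𝔘, hU, ContinuousOn.neg ha⟩

variable {X V} in
theorem d_mem_contCochains (n : ℕ) (f : Cochain X V n) (hf : f ∈ contCochains X V n) :
    d X V n f ∈ contCochains X V (n + 1) := by
  have hf' : Continuous f := hf
  change Continuous fun x : Fin (n + 2) → X =>
    ∑ i : Fin (n + 2), (-1 : ℤ) ^ (i : ℕ) • f (fun j => x (i.succAbove j))
  refine continuous_finsetSum _ fun i _ => Continuous.const_smul ?_ ((-1 : ℤ) ^ (i : ℕ))
  exact hf'.comp (by fun_prop)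

variable {X V} in
theorem d_mem_germCochains (n : ℕ) (f : Cochain X V n) (hf : f ∈ germCochains X V n) :
    d X V n f ∈ germCochains X V (n + 1) := by
  obtain ⟨𝔘, hU, hf⟩ := hf
  refine ⟨𝔘, hU, ?_⟩
  change ContinuousOn
    (fun x : Fin (n + 2) → X => ∑ i : Fin (n + 2), (-1 : ℤ) ^ (i : ℕ) • f (fun j => x (i.succAbove j))) _
  refine continuousOn_finsetSum _ fun i _ => ContinuousOn.fun_const_smul ?_ ((-1 : ℤ) ^ (i : ℕ))
  refine hf.comp (Continuous.continuousOn (by fun_prop)) fun x hx => ?_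
  simp only [diagNhd, Set.mem_iUnion, Set.mem_ofPred_eq] at hx ⊢
  obtain ⟨U, hU', hx⟩ := hx
  exact ⟨U, hU', fun j => hx _⟩

variable {X V} in
theorem contCochains_le_germCochains (n : ℕ) : contCochains X V n ≤ germCochains X V n :=
  fun f hf => ⟨{Set.univ}, ⟨by simp, by simp⟩, Continuous.continuousOn hf⟩

/-- The complex `A_c^* (X;V)^G` of continuous equivariant cochains.  For `X = G` with the action
by left translation this is the complex of continuous homogeneous group cochains. -/
noncomputable def contComplex : CochainComplex AddCommGrpCat.{max u v} ℕ :=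
  subcomplex (fun n => contCochains X V n ⊓ eqCochains G X V n)
    (fun n f hf => ⟨d_mem_contCochains n f hf.1, d_mem_eqCochains n f hf.2⟩)

/-- The complex `A_{cg}^* (X;V)^G` of equivariant cochains with continuous germ at the diagonal.
For `X = G` with the action by left translation this is the complex of homogeneous group cochains
with continuous germ at the diagonal. -/
noncomputable def germComplex : CochainComplex AddCommGrpCat.{max u v} ℕ :=
  subcomplex (fun n => germCochains X V n ⊓ eqCochains G X V n)
    (fun n f hf => ⟨d_mem_germCochains n f hf.1, d_mem_eqCochains n f hf.2⟩)

/-- The inclusion `A_c^* (X;V)^G ↪ A_{cg}^* (X;V)^G` of cochain complexes. -/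
noncomputable def contToGerm : contComplex G X V ⟶ germComplex G X V :=
  subcomplexInclusion _ _ (fun n => inf_le_inf_right _ (contCochains_le_germCochains n))

end Groups

end EqCoh

/-! An injective cochain map is a quasi-isomorphism once every target cochain with coboundary in the
image lies in the image up to a coboundary (`isIso_homologyMap_of_exists`). So let f be equivariant
with continuous germ and c = df continuous; wanted is an equivariant e with continuous germ such
that f + de is continuous.

Consider cochains g(xs, ys) of two lists, jointly continuous wherever ys is small on a scale that
may depend on xs (`NumerablyContinuous`). Contractibility makes the ys-direction exact, continuously
in xs: a contraction is cut into steps so short that the prism operators meet only small tuples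
(`exists_numerablyContinuous_primitive`). Starting from g([], ys) = f(ys), one solves d_xs g +
(-1)^|xs| d_ys g = c(xs ++ ys) by induction on |xs| (`exists_zigzag`); equivariance is kept by
solving for xs with head 1 and translating.

Put B = (-1)^|xs| g and e(y_0, …, y_n) = ∑ B(y_0, …, y_p)(y_p, …, y_n). This Alexander–Whitney map
commutes with differentials up to the augmentation terms B([], l) = f(l) and ±B(l, [])
(`alexanderWhitney_totalD`). Hence f + de is ±B(l, []) minus the image of a continuous cochain.
Smallness of the empty tuple is vacuous, so B(l, []) is continuous everywhere; e has continuous germ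
because tuples near the diagonal are small (`exists_correction`).

Smallness is measured by continuous pseudometrics rather than coverings, so that the step length can
be chosen continuously. For f, equivariance makes the covering uniform, and the left uniformity of G
supplies the pseudometric (`exists_continuous_pseudometric`). Lists carry all degrees at once, and
the empty list is the augmentation. -/

namespace EqCoh

/-! ### Cochains on lists -/

section ListCochains

variable {X : Type u} {V : Type v} [AddCommGroup V]

/-- The augmented differential of a cochain on lists: the alternating sum over all ways of
deleting one entry. -/
def listD : (List X → V) → List X → V
  | _, [] => 0
  | F, x :: l => F l - listD (fun m => F (x :: m)) l

@[simp] theorem listD_nil (F : List X → V) : listD F [] = 0 := rfl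

theorem listD_cons (F : List X → V) (x : X) (l : List X) :
    listD F (x :: l) = F l - listD (fun m => F (x :: m)) l := rfl

@[simp] theorem listD_zero (l : List X) : listD (fun _ => (0 : V)) l = 0 := by
  induction l with
  | nil => rfl
  | cons x l ih => simp [listD_cons, ih]

theorem listD_add (F F' : List X → V) (l : List X) :
    listD (fun m => F m + F' m) l = listD F l + listD F' l := by
  induction l generalizing F F' with
  | nil => simp
  | cons x l ih => simp only [listD_cons, ih]; abel

theorem listD_neg (F : List X → V) (l : List X) :
    listD (fun m => -F m) l = -listD F l := by
  induction l generalizing F with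
  | nil => simp
  | cons x l ih => simp only [listD_cons, ih]; abel

theorem listD_sub (F F' : List X → V) (l : List X) :
    listD (fun m => F m - F' m) l = listD F l - listD F' l := by
  simp only [sub_eq_add_neg, listD_add, listD_neg]

theorem listD_zsmul (c : ℤ) (F : List X → V) (l : List X) :
    listD (fun m => c • F m) l = c • listD F l := by
  induction l generalizing F with
  | nil => simp
  | cons x l ih => simp only [listD_cons, ih, smul_sub]

theorem listD_sum {ι : Type*} (s : Finset ι) (F : ι → List X → V) (l : List X) :
    listD (fun m => ∑ i ∈ s, F i m) l = ∑ i ∈ s, listD (F i) l := by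
  classical
  induction s using Finset.induction_on with
  | empty => simp
  | insert a s ha ih => simp only [Finset.sum_insert ha, listD_add, ih]

/-- The differential at `l` only depends on the values at the faces of `l`. -/
theorem listD_congr {F F' : List X → V} {l : List X}
    (h : ∀ m, m.length + 1 = l.length → m.Sublist l → F m = F' m) : listD F l = listD F' l := by
  induction l generalizing F F' with
  | nil => rfl
  | cons x l ih =>
    rw [listD_cons, listD_cons, h l rfl (List.sublist_cons_self x l),
      ih fun m hm hs => h (x :: m) (by simp [hm]) (hs.cons_cons x)]

theorem listD_listD (F : List X → V) (l : List X) : listD (listD F) l = 0 := by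
  induction l generalizing F with
  | nil => rfl
  | cons x l ih => simp only [listD_cons, listD_sub, ih]; abel

/-- For a cocycle `F` the left side vanishes, so the two partial differentials of `F (xs ++ ys)`
agree up to sign; the zigzag rests on this. -/
theorem listD_append (F : List X → V) (xs ys : List X) :
    listD F (xs ++ ys) = listD (fun m => F (m ++ ys)) xs +
      (-1 : ℤ) ^ xs.length • listD (fun m => F (xs ++ m)) ys := by
  induction xs generalizing F with
  | nil => simp
  | cons x xs ih =>
    simp only [List.cons_append, listD_cons, ih, List.length_cons, pow_succ]
    simp only [mul_neg, mul_one, neg_smul]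
    abel

theorem listD_map {X' : Type w} (a : X' → X) (F : List X → V) (l : List X') :
    listD (fun m => F (m.map a)) l = listD F (l.map a) := by
  induction l generalizing F with
  | nil => rfl
  | cons x l ih => simp only [listD_cons, List.map_cons, ← ih]

theorem listD_comm {X' : Type w} (B : List X → List X' → V) (xs : List X) (ys : List X') :
    listD (fun m => listD (fun n => B m n) ys) xs =
      listD (fun n => listD (fun m => B m n) xs) ys := by
  induction xs generalizing B with
  | nil => simp
  | cons x xs ih => simp only [listD_cons, listD_sub, ih]

theorem map_listD {W : Type w} [AddCommGroup W] (φ : V →+ W) (F : List X → V) (l : List X) :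
    φ (listD F l) = listD (fun m => φ (F m)) l := by
  induction l generalizing F with
  | nil => simp
  | cons x l ih => simp only [listD_cons, map_sub, ih]

theorem listD_ofFn (n : ℕ) (F : List X → V) (x : Fin (n + 1) → X) :
    listD F (List.ofFn x) =
      ∑ i : Fin (n + 1), (-1 : ℤ) ^ (i : ℕ) • F (List.ofFn fun j => x (i.succAbove j)) := by
  induction n generalizing F with
  | zero => simp [listD_cons]
  | succ n ih =>
    rw [Fin.sum_univ_succ, List.ofFn_succ, listD_cons, ih, sub_eq_add_neg,
      ← Finset.sum_neg_distrib]
    congr 1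
    · simp
    · refine Finset.sum_congr rfl fun i _ => ?_
      rw [List.ofFn_succ]
      simp [pow_succ]

/-! ### The Alexander–Whitney map -/

/-- The Alexander–Whitney map on cochains in two list variables:
`∑ p, B (y_0, …, y_p) (y_p, …, y_n)`. -/
def alexanderWhitney : (List X → List X → V) → List X → V
  | _, [] => 0
  | B, y :: l => B [y] (y :: l) + alexanderWhitney (fun xs => B (y :: xs)) l

@[simp] theorem alexanderWhitney_nil (B : List X → List X → V) : alexanderWhitney B [] = 0 := rfl

theorem alexanderWhitney_cons (B : List X → List X → V) (y : X) (l : List X) :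
    alexanderWhitney B (y :: l) = B [y] (y :: l) + alexanderWhitney (fun xs => B (y :: xs)) l := rfl

theorem alexanderWhitney_sub (B B' : List X → List X → V) (l : List X) :
    alexanderWhitney (fun xs ys => B xs ys - B' xs ys) l =
      alexanderWhitney B l - alexanderWhitney B' l := by
  induction l generalizing B B' with
  | nil => simp
  | cons x l ih => simp only [alexanderWhitney_cons, ih]; abel

theorem alexanderWhitney_congr {B B' : List X → List X → V} {l : List X}
    (h : ∀ xs ys, xs.length ≤ l.length → B xs ys = B' xs ys) :
    alexanderWhitney B l = alexanderWhitney B' l := by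
  induction l generalizing B B' with
  | nil => rfl
  | cons x l ih =>
    rw [alexanderWhitney_cons, alexanderWhitney_cons, h _ _ (by simp),
      ih fun xs ys hxs => h (x :: xs) ys (by simpa using hxs)]

/-- The total differential of a cochain in two list variables. -/
def totalD (B : List X → List X → V) (xs ys : List X) : V :=
  listD (fun m => B m ys) xs - (-1 : ℤ) ^ xs.length • listD (B xs) ys

/-- Peeling off the head of the first list mirrors the recursion of `alexanderWhitney`. -/
theorem totalD_cons (B : List X → List X → V) (x : X) (xs ys : List X) :
    totalD B (x :: xs) ys = B xs ys - totalD (fun m => B (x :: m)) xs ys := by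
  simp only [totalD, listD_cons, List.length_cons, pow_succ, mul_neg, mul_one, neg_smul]
  abel

/-- The Alexander–Whitney map is a cochain map up to the two augmentation terms. -/
theorem alexanderWhitney_totalD (B : List X → List X → V) (l : List X) :
    alexanderWhitney (totalD B) l =
      listD (alexanderWhitney B) l + B [] l - (-1 : ℤ) ^ l.length • B l [] := by
  induction l generalizing B with
  | nil => simp
  | cons y l ih =>
    have h : alexanderWhitney (fun xs => totalD B (y :: xs)) l =
        alexanderWhitney B l - alexanderWhitney (totalD fun m => B (y :: m)) l := by
      rw [← alexanderWhitney_sub]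
      congr 1
      funext xs ys
      exact totalD_cons B y xs ys
    rw [alexanderWhitney_cons, h, ih, listD_cons]
    simp only [alexanderWhitney_cons, listD_add, totalD, listD_cons, listD_nil, List.length_cons,
      List.length_nil, pow_succ, pow_zero, mul_neg, mul_one, neg_smul, one_smul]
    abel

/-! ### Prism operators -/

/-- The prism operator of two self-maps `a`, `b`:
`∑ k, (-1)^k F (a x_0, …, a x_k, b x_k, …, b x_q)`. -/
def prism (a b : X → X) : (List X → V) → List X → V
  | _, [] => 0
  | F, x :: l => F (a x :: b x :: l.map b) - prism a b (fun m => F (a x :: m)) l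

@[simp] theorem prism_nil (a b : X → X) (F : List X → V) : prism a b F [] = 0 := rfl

theorem prism_cons (a b : X → X) (F : List X → V) (x : X) (l : List X) :
    prism a b F (x :: l) =
      F (a x :: b x :: l.map b) - prism a b (fun m => F (a x :: m)) l := rfl

theorem prism_sub (a b : X → X) (F F' : List X → V) (l : List X) :
    prism a b (fun m => F m - F' m) l = prism a b F l - prism a b F' l := by
  induction l generalizing F F' with
  | nil => simp
  | cons x l ih => simp only [prism_cons, ih]; abel

@[simp] theorem prism_zero (a b : X → X) (l : List X) :
    prism a b (fun _ => (0 : V)) l = 0 := by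
  induction l with
  | nil => rfl
  | cons x l ih => simp [prism_cons, ih]

theorem prism_congr {a b a' b' : X → X} (F : List X → V) {l : List X}
    (ha : ∀ x ∈ l, a x = a' x) (hb : ∀ x ∈ l, b x = b' x) :
    prism a b F l = prism a' b' F l := by
  induction l generalizing F with
  | nil => rfl
  | cons x l ih =>
    rw [prism_cons, prism_cons, ha x (by simp), hb x (by simp),
      List.map_congr_left fun y hy => hb y (List.mem_cons_of_mem x hy),
      ih _ (fun y hy => ha y (List.mem_cons_of_mem x hy))
        (fun y hy => hb y (List.mem_cons_of_mem x hy))]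

theorem listD_prism_add (a b : X → X) (F : List X → V) (l : List X) :
    listD (prism a b F) l + prism a b (listD F) l = F (l.map b) - F (l.map a) := by
  induction l generalizing F with
  | nil => simp
  | cons x l ih =>
    have h1 : prism a b (fun m => listD F (a x :: m)) l =
        prism a b F l - prism a b (listD fun m => F (a x :: m)) l := by
      rw [← prism_sub]; rfl
    have h2 := ih fun m => F (a x :: m)
    have h3 := listD_map b (fun m => F (a x :: b x :: m)) l
    rw [prism_cons, h1, listD_cons, listD_cons, listD_cons]
    simp only [prism_cons, listD_sub, List.map_cons, h3] at *
    rw [eq_sub_of_add_eq' h2]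
    abel

/-- For a cocycle `F` and a sequence of maps `h`, the part of the prism operators between `h 0`
and `h N`, each corrected by the prism operator of the constant homotopy. -/
def prismSum (h : ℕ → X → X) (F : List X → V) (N : ℕ) (l : List X) : V :=
  ∑ k ∈ Finset.range N, (prism (h k) (h (k + 1)) F l - prism id id F l)

/-- The sum telescopes; the constant-homotopy corrections are cocycles and contribute nothing. -/
theorem listD_prismSum (h : ℕ → X → X) {F : List X → V} (hF : ∀ l, listD F l = 0) (N : ℕ)
    (l : List X) : listD (prismSum h F N) l = F (l.map (h N)) - F (l.map (h 0)) := by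
  have hF' : listD F = fun _ => 0 := funext hF
  have key : ∀ a b : X → X, listD (prism a b F) l = F (l.map b) - F (l.map a) := fun a b => by
    simpa [hF'] using listD_prism_add a b F l
  change listD (fun m => ∑ k ∈ Finset.range N, _) l = _
  rw [listD_sum]
  simp only [listD_sub, key, sub_self, sub_zero]
  exact Finset.sum_range_sub (fun k => F (l.map (h k))) N

/-- Degenerate prisms need not vanish on unnormalized cochains. Subtracting the prism of the
identity makes the stationary steps cancel, so the sum stabilizes. -/
theorem prismSum_eq_of_le {h : ℕ → X → X} (F : List X → V) {N M : ℕ} (hNM : N ≤ M) {l : List X}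
    (hl : ∀ k, N ≤ k → ∀ x ∈ l, h k x = x) : prismSum h F M l = prismSum h F N l := by
  refine (Finset.sum_subset (Finset.range_mono hNM) fun k _ hk => ?_).symm
  have hk' : N ≤ k := by simpa using hk
  rw [prism_congr F (a' := id) (b' := id) (fun x hx => hl k hk' x hx)
    (fun x hx => hl (k + 1) (by omega) x hx), sub_self]

/-- The cocycle condition at `(b, b, …, b)`; this disposes of the contracted end of the homotopy. -/
theorem listD_cone (b : X) {F : List X → V} (hF : ∀ l, listD F l = 0) (l : List X) :
    listD (fun m => F (b :: m.map fun _ => b)) l = F (l.map fun _ => b) := by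
  have h := hF (b :: l.map fun _ => b)
  rw [listD_cons, sub_eq_zero] at h
  rw [h]
  exact listD_map (fun _ => b) (fun m => F (b :: m)) l

end ListCochains

end EqCoh

namespace EqCoh

open Filter Topology

theorem continuousAt_comp {A B C : Type*} [TopologicalSpace A] [TopologicalSpace B]
    [TopologicalSpace C] {f : A → B} {g : B → C} {b : B} (a : A) (hg : ContinuousAt g b)
    (hf : Continuous f) (hab : f a = b) : ContinuousAt (fun x => g (f x)) a :=
  ContinuousAt.comp (hab ▸ hg) hf.continuousAt

/-! ### Topology of the space of lists -/

section ListTopology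

variable {X : Type u} [TopologicalSpace X] {Y : Type w} [TopologicalSpace Y]

@[fun_prop]
theorem continuous_list_cons {f : Y → X} {g : Y → List X} (hf : Continuous f)
    (hg : Continuous g) : Continuous fun y => f y :: g y :=
  List.continuous_cons.comp (hf.prodMk hg)

theorem nhds_prod_nil (y : Y) : 𝓝 (y, ([] : List X)) = map (fun y => (y, [])) (𝓝 y) := by
  rw [nhds_prod_eq, nhds_nil, prod_pure]

/-- The head of the list joins the parameter. Continuity on lists is thus proved by induction on the
list with the parameter space generalized. -/
theorem nhds_prod_cons (y : Y) (x : X) (l : List X) :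
    𝓝 (y, x :: l) = map (fun p : (Y × X) × List X => (p.1.1, p.1.2 :: p.2)) (𝓝 ((y, x), l)) := by
  have h : 𝓝 (x :: l) = map (fun p : X × List X => p.1 :: p.2) (𝓝 x ×ˢ 𝓝 l) := by
    refine le_antisymm ?_ List.tendsto_cons
    exact List.tendsto_cons_iff.1 (tendsto_id (x := 𝓝 (x :: l))) |> fun _ =>
      (List.tendsto_cons_iff (f := id)).2 tendsto_map
  rw [nhds_prod_eq, h, nhds_prod_eq, nhds_prod_eq, ← Filter.map_id (f := 𝓝 y),
    Filter.prod_map_map_eq, Filter.map_id, ← prod_assoc, Filter.map_map]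
  rfl

theorem continuousAt_nil_iff {Z : Type*} [TopologicalSpace Z] {Φ : Y × List X → Z} {y : Y} :
    ContinuousAt Φ (y, []) ↔ ContinuousAt (fun y => Φ (y, [])) y := by
  rw [ContinuousAt, nhds_prod_nil, tendsto_map'_iff]
  rfl

theorem continuousAt_cons_iff {Z : Type*} [TopologicalSpace Z] {Φ : Y × List X → Z} {y : Y}
    {x : X} {l : List X} :
    ContinuousAt Φ (y, x :: l) ↔
      ContinuousAt (fun p : (Y × X) × List X => Φ (p.1.1, p.1.2 :: p.2)) ((y, x), l) := by
  rw [ContinuousAt, nhds_prod_cons, tendsto_map'_iff]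
  rfl

theorem eventually_forall_mem {P : Y → X → Prop} {y : Y} {l : List X}
    (h : ∀ x ∈ l, ∀ᶠ q in 𝓝 (y, x), P q.1 q.2) :
    ∀ᶠ q in 𝓝 (y, l), ∀ x ∈ q.2, P q.1 x := by
  induction l with
  | nil => simp [nhds_prod_nil]
  | cons x l ih =>
    rw [nhds_prod_cons, eventually_map]
    have h1 : Tendsto (fun p : (Y × X) × List X => p.1) (𝓝 ((y, x), l)) (𝓝 (y, x)) :=
      continuous_fst.continuousAt
    have h2 : Tendsto (fun p : (Y × X) × List X => (p.1.1, p.2)) (𝓝 ((y, x), l)) (𝓝 (y, l)) :=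
      Continuous.continuousAt (by fun_prop)
    filter_upwards [h1.eventually (h x (by simp)),
      h2.eventually (ih fun z hz => h z (List.mem_cons_of_mem x hz))] with p hp1 hp2
    simpa using ⟨hp1, hp2⟩

theorem continuous_list_map_prod {X' : Type*} [TopologicalSpace X'] {a : Y → X → X'}
    (ha : Continuous fun p : Y × X => a p.1 p.2) :
    Continuous fun p : Y × List X => p.2.map (a p.1) := by
  refine continuous_iff_continuousAt.2 fun ⟨y, l⟩ => ?_
  induction l with
  | nil => exact continuousAt_nil_iff.2 continuousAt_const
  | cons x l ih =>
    refine continuousAt_cons_iff.2 ?_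
    refine ContinuousAt.comp (f := fun p : (Y × X) × List X => (a p.1.1 p.1.2, p.2.map (a p.1.1)))
      (g := fun q : X' × List X' => q.1 :: q.2) (by fun_prop) (ContinuousAt.prodMk ?_ ?_)
    · exact (ha.comp continuous_fst).continuousAt
    · exact (continuousAt_comp (f := fun p : (Y × X) × List X => (p.1.1, p.2)) ((y, x), l) ih
        (by fun_prop) rfl :)

@[fun_prop]
theorem continuous_list_map {X' : Type*} [TopologicalSpace X'] {a : Y → X → X'} {g : Y → List X}
    (ha : Continuous fun p : Y × X => a p.1 p.2) (hg : Continuous g) :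
    Continuous fun y => (g y).map (a y) :=
  (continuous_list_map_prod ha).comp (continuous_id.prodMk hg)

theorem continuous_append : Continuous fun p : List X × List X => p.1 ++ p.2 := by
  suffices h : Continuous fun p : List X × List X => p.2 ++ p.1 from
    h.comp (continuous_snd.prodMk continuous_fst)
  refine continuous_iff_continuousAt.2 fun ⟨y, l⟩ => ?_
  induction l with
  | nil => exact continuousAt_nil_iff.2 continuousAt_id
  | cons x l ih =>
    refine continuousAt_cons_iff.2 ?_
    refine ContinuousAt.comp (f := fun p : (List X × X) × List X => (p.1.2, p.2 ++ p.1.1))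
      (g := fun q : X × List X => q.1 :: q.2) (by fun_prop) (ContinuousAt.prodMk (by fun_prop) ?_)
    exact (continuousAt_comp (f := fun p : (List X × X) × List X => (p.1.1, p.2)) ((y, x), l) ih
      (by fun_prop) rfl :)

theorem continuous_ofFn (n : ℕ) : Continuous fun x : Fin n → X => List.ofFn x := by
  induction n with
  | zero => simpa using continuous_const
  | succ n ih =>
    simp only [List.ofFn_succ]
    exact continuous_list_cons (continuous_apply 0) (ih.comp (by fun_prop))

theorem continuous_getD (x₀ : X) (i : ℕ) : Continuous fun l : List X => l.getD i x₀ := by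
  refine continuous_iff_continuousAt.2 fun l => ?_
  suffices h : ContinuousAt (fun p : Unit × List X => p.2.getD i x₀) ((), l) from
    (continuousAt_comp (f := fun l : List X => ((), l)) l h
      (continuous_const.prodMk continuous_id) rfl :)
  induction l generalizing i with
  | nil => exact continuousAt_nil_iff.2 continuousAt_const
  | cons x l ih =>
    refine continuousAt_cons_iff.2 ?_
    cases i with
    | zero => simp only [List.getD_cons_zero]; fun_prop
    | succ i =>
      simp only [List.getD_cons_succ]
      exact (continuousAt_comp (f := fun p : (Unit × X) × List X => ((), p.2)) (((), x), l)
        (ih i) (continuous_const.prodMk continuous_snd) rfl :)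

theorem continuous_take (i : ℕ) : Continuous fun l : List X => l.take i := by
  refine continuous_iff_continuousAt.2 fun l => ?_
  suffices h : ContinuousAt (fun p : Unit × List X => p.2.take i) ((), l) from
    (continuousAt_comp (f := fun l : List X => ((), l)) l h
      (continuous_const.prodMk continuous_id) rfl :)
  induction l generalizing i with
  | nil => exact continuousAt_nil_iff.2 (by simpa using continuousAt_const)
  | cons x l ih =>
    refine continuousAt_cons_iff.2 ?_
    cases i with
    | zero => simpa using continuousAt_const
    | succ i =>
      simp only [List.take_succ_cons]
      refine ContinuousAt.comp (f := fun p : (Unit × X) × List X => (p.1.2, p.2.take i))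
        (g := fun q : X × List X => q.1 :: q.2) (by fun_prop) (ContinuousAt.prodMk (by fun_prop) ?_)
      exact (continuousAt_comp (f := fun p : (Unit × X) × List X => ((), p.2)) (((), x), l)
        (ih i) (continuous_const.prodMk continuous_snd) rfl :)

/-- The parameter `x` can be moved into the list. -/
theorem continuousAt_cons_shift {V : Type*} [TopologicalSpace V] {F : Y → List X → V}
    {a : Y → X → X} (ha : Continuous fun p : Y × X => a p.1 p.2) {y : Y} {x : X} {l : List X}
    (h : ContinuousAt (fun p : Y × List X => F p.1 p.2) (y, a y x :: l)) :
    ContinuousAt (fun p : (Y × X) × List X => F p.1.1 (a p.1.1 p.1.2 :: p.2)) ((y, x), l) :=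
  (continuousAt_comp (f := fun p : (Y × X) × List X => (p.1.1, a p.1.1 p.1.2 :: p.2))
    ((y, x), l) h (by fun_prop) rfl :)

theorem eventually_length_eq (l : List X) : ∀ᶠ m in 𝓝 l, m.length = l.length :=
  (List.continuousAt_length l).eventually (mem_nhds_discrete.2 (Set.mem_singleton _))

end ListTopology

/-! ### Continuity of the list operators with parameters -/

section Continuity

variable {X Y : Type u} [TopologicalSpace X] [TopologicalSpace Y]
  {V : Type v} [AddCommGroup V] [TopologicalSpace V] [IsTopologicalAddGroup V]

theorem continuousAt_listD {F : Y → List X → V} {y : Y} {l : List X}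
    (h : ∀ i < l.length, ContinuousAt (fun p : Y × List X => F p.1 p.2) (y, l.eraseIdx i)) :
    ContinuousAt (fun p : Y × List X => listD (F p.1) p.2) (y, l) := by
  induction l generalizing Y with
  | nil => exact continuousAt_nil_iff.2 continuousAt_const
  | cons x l ih =>
    refine continuousAt_cons_iff.2 ?_
    simp only [listD_cons]
    refine ContinuousAt.sub ?_ (ih (F := fun (q : Y × X) m => F q.1 (q.2 :: m)) fun i hi => ?_)
    · exact (continuousAt_comp (f := fun p : (Y × X) × List X => (p.1.1, p.2)) ((y, x), l)
        (h 0 (by simp)) (by fun_prop) rfl :)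
    · exact continuousAt_cons_shift (a := fun _ x => x) continuous_snd
        (h (i + 1) (by simpa using hi))

/-- Only the entries of `m` are constrained, not its shape: this is what a smallness condition can
verify. -/
theorem continuousAt_prism {F : Y → List X → V} {a b : Y → X → X}
    (ha : Continuous fun p : Y × X => a p.1 p.2) (hb : Continuous fun p : Y × X => b p.1 p.2)
    {y : Y} {l : List X}
    (h : ∀ m, (∀ z ∈ m, ∃ x ∈ l, z = a y x ∨ z = b y x) →
      ContinuousAt (fun p : Y × List X => F p.1 p.2) (y, m)) :
    ContinuousAt (fun p : Y × List X => prism (a p.1) (b p.1) (F p.1) p.2) (y, l) := by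
  induction l generalizing Y with
  | nil => exact continuousAt_nil_iff.2 continuousAt_const
  | cons x l ih =>
    refine continuousAt_cons_iff.2 ?_
    simp only [prism_cons]
    refine ContinuousAt.sub ?_ (ih (F := fun (q : Y × X) m => F q.1 (a q.1 q.2 :: m))
      (a := fun q => a q.1) (b := fun q => b q.1) ?_ ?_ fun m hm => ?_)
    · have hb' : Continuous fun p : ((Y × X) × List X) × X => b p.1.1.1 p.2 :=
        hb.comp (f := fun p : ((Y × X) × List X) × X => (p.1.1.1, p.2)) (by fun_prop)
      have ha1 : Continuous fun p : (Y × X) × List X => a p.1.1 p.1.2 := by fun_prop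
      have hb1 : Continuous fun p : (Y × X) × List X => b p.1.1 p.1.2 := by fun_prop
      refine (continuousAt_comp (f := fun p : (Y × X) × List X =>
        (p.1.1, a p.1.1 p.1.2 :: b p.1.1 p.1.2 :: p.2.map (b p.1.1))) ((y, x), l)
        (h _ ?_) ?_ rfl :)
      · intro z hz
        simp only [List.mem_cons, List.mem_map] at hz
        rcases hz with rfl | rfl | ⟨w, hw, rfl⟩
        · exact ⟨x, by simp, Or.inl rfl⟩
        · exact ⟨x, by simp, Or.inr rfl⟩
        · exact ⟨w, by simp [hw], Or.inr rfl⟩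
      · exact (continuous_fst.comp continuous_fst).prodMk
          (continuous_list_cons ha1 (continuous_list_cons hb1
            (continuous_list_map hb' continuous_snd)))
    · exact ha.comp (f := fun p : (Y × X) × X => (p.1.1, p.2)) (by fun_prop)
    · exact hb.comp (f := fun p : (Y × X) × X => (p.1.1, p.2)) (by fun_prop)
    · refine continuousAt_cons_shift ha (h (a y x :: m) fun z hz => ?_)
      rcases List.mem_cons.1 hz with rfl | hz
      · exact ⟨x, by simp, Or.inl rfl⟩
      · obtain ⟨w, hw, hw'⟩ := hm z hz
        exact ⟨w, by simp [hw], hw'⟩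

theorem continuousAt_alexanderWhitney {B : Y → List X → List X → V} {y : Y} {l : List X}
    (h : ∀ s x t, l = s ++ x :: t →
      ContinuousAt (fun p : Y × (List X × List X) => B p.1 p.2.1 p.2.2) (y, (s ++ [x], x :: t))) :
    ContinuousAt (fun p : Y × List X => alexanderWhitney (B p.1) p.2) (y, l) := by
  induction l generalizing Y with
  | nil => exact continuousAt_nil_iff.2 continuousAt_const
  | cons x l ih =>
    refine continuousAt_cons_iff.2 ?_
    simp only [alexanderWhitney_cons]
    refine ContinuousAt.add ?_ (ih (B := fun (q : Y × X) xs => B q.1 (q.2 :: xs))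
      fun s x' t hl => ?_)
    · exact (continuousAt_comp
        (f := fun p : (Y × X) × List X => (p.1.1, ([p.1.2], p.1.2 :: p.2))) ((y, x), l)
        (h [] x l rfl) (by fun_prop) rfl :)
    · exact (continuousAt_comp (f := fun p : (Y × X) × (List X × List X) =>
        (p.1.1, (p.1.2 :: p.2.1, p.2.2))) ((y, x), (s ++ [x'], x' :: t))
        (h (x :: s) x' t (by simp [hl])) (by fun_prop) rfl :)

end Continuity

end EqCoh

namespace EqCoh

open Filter Topology unitInterval

/-! ### Step lengths for a contraction -/

section Mesh

variable {X Y : Type u} {D : Y → X → X → ℝ} {H : X → I → X}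

/-- A scale below which the path `H x` moves by less than `1/3`. -/
noncomputable def mesh (D : Y → X → X → ℝ) (H : X → I → X) (p : Y × X) : ℝ :=
  sInf ((fun st : I × I => |(st.1 : ℝ) - st.2| +
    max 0 (1 / 3 - D p.1 (H p.2 st.1) (H p.2 st.2))) '' Set.univ)

/-- If the distance were at least `1/3`, the second summand would vanish and `|s - t|` would be one
of the values bounded below by the infimum. -/
theorem dist_lt_of_lt_mesh {p : Y × X} {s t : I} (h : |(s : ℝ) - t| < mesh D H p) :
    D p.1 (H p.2 s) (H p.2 t) < 1 / 3 := by
  by_contra! hn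
  refine absurd h (not_lt.2 (csInf_le ⟨0, ?_⟩ ⟨(s, t), trivial, ?_⟩))
  · rintro _ ⟨st, -, rfl⟩
    positivity
  · simp only
    rw [max_eq_left (by linarith), add_zero]

end Mesh

/-! ### Numerable continuity and exactness over a contractible space -/

section Numerable

variable {X Y : Type u} [TopologicalSpace X] [TopologicalSpace Y]

/-- A jointly continuous family of (not necessarily symmetric) pseudometrics on `X`
parametrized by `Y`. -/
structure IsPMetricFamily (D : Y → X → X → ℝ) : Prop where
  cont : Continuous fun p : Y × X × X => D p.1 p.2.1 p.2.2
  self : ∀ y a, D y a a = 0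
  nonneg : ∀ y a b, 0 ≤ D y a b
  triangle : ∀ y a b c, D y a c ≤ D y a b + D y b c

/-- A parametrized cochain is numerably continuous if it is continuous at all tuples whose entries
are at distance less than `1` from each other, for some continuous family of pseudometrics. -/
def NumerablyContinuous {V : Type v} [TopologicalSpace V] (F : Y → List X → V) : Prop :=
  ∃ D : Y → X → X → ℝ, IsPMetricFamily D ∧ ∀ y l, (∀ a ∈ l, ∀ b ∈ l, D y a b < 1) →
    ContinuousAt (fun p : Y × List X => F p.1 p.2) (y, l)

section Steps

variable {D : Y → X → X → ℝ} {H : X → I → X}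

theorem continuous_mesh_integrand (hD : IsPMetricFamily D)
    (hH : Continuous fun p : X × I => H p.1 p.2) :
    Continuous fun q : (Y × X) × (I × I) => |(q.2.1 : ℝ) - q.2.2| +
      max 0 (1 / 3 - D q.1.1 (H q.1.2 q.2.1) (H q.1.2 q.2.2)) := by
  have h1 : Continuous fun q : (Y × X) × (I × I) => H q.1.2 q.2.1 :=
    hH.comp (f := fun q : (Y × X) × (I × I) => (q.1.2, q.2.1)) (by fun_prop)
  have h2 : Continuous fun q : (Y × X) × (I × I) => H q.1.2 q.2.2 :=
    hH.comp (f := fun q : (Y × X) × (I × I) => (q.1.2, q.2.2)) (by fun_prop)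
  have h3 : Continuous fun q : (Y × X) × (I × I) =>
      D q.1.1 (H q.1.2 q.2.1) (H q.1.2 q.2.2) :=
    hD.cont.comp (f := fun q : (Y × X) × (I × I) =>
      (q.1.1, H q.1.2 q.2.1, H q.1.2 q.2.2)) (by fun_prop)
  exact (Continuous.abs (by fun_prop)).add (continuous_const.max (continuous_const.sub h3))

/-- An infimum over the compact square `I × I` depends continuously on the parameters. -/
theorem continuous_mesh (hD : IsPMetricFamily D) (hH : Continuous fun p : X × I => H p.1 p.2) :
    Continuous (mesh D H) :=
  IsCompact.continuous_sInf
    (f := fun (p : Y × X) (st : I × I) => |(st.1 : ℝ) - st.2| +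
      max 0 (1 / 3 - D p.1 (H p.2 st.1) (H p.2 st.2)))
    isCompact_univ (continuous_mesh_integrand hD hH)

/-- The infimum is attained: on the diagonal the value is `1/3`, off it `|s - t|` is positive. -/
theorem mesh_pos (hD : IsPMetricFamily D) (hH : Continuous fun p : X × I => H p.1 p.2)
    (p : Y × X) : 0 < mesh D H p := by
  have hc := (continuous_mesh_integrand hD hH).comp
    (f := fun st : I × I => (p, st)) (by fun_prop)
  obtain ⟨⟨s, t⟩, -, hst⟩ := (isCompact_univ.image hc).sInf_mem (Set.univ_nonempty.image _)
  change 0 < sInf _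
  refine lt_of_lt_of_eq ?_ hst
  simp only [Function.comp_apply]
  by_cases h : s = t
  · subst h
    simp [hD.self]
  · have h' : (s : ℝ) - t ≠ 0 := fun h' => h (Subtype.ext (sub_eq_zero.1 h'))
    have := abs_pos.2 h'
    positivity

/-- A contraction of `X` can be cut into steps of length less than `1/3`, locally finite in
number, by a sequence of continuous maps. -/
theorem exists_steps (hD : IsPMetricFamily D) (hH : Continuous fun p : X × I => H p.1 p.2)
    {b : X} (h0 : ∀ x, H x 0 = b) (h1 : ∀ x, H x 1 = x) :
    ∃ h : ℕ → Y → X → X, (∀ k, Continuous fun p : Y × X => h k p.1 p.2) ∧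
      (∀ y x, h 0 y x = b) ∧
      (∀ y x, ∃ M, ∀ᶠ q in 𝓝 (y, x), ∀ k, M ≤ k → h k q.1 q.2 = q.2) ∧
      ∀ k y x, D y (h k y x) (h (k + 1) y x) < 1 / 3 ∧
        D y (h (k + 1) y x) (h k y x) < 1 / 3 := by
  have hm := continuous_mesh hD hH
  have hpos := mesh_pos hD hH
  -- Time advances by half the mesh, so consecutive times differ by strictly less than the mesh.
  let τ : ℕ → Y → X → I := fun k y x =>
    Set.projIcc 0 1 zero_le_one (k * (mesh D H (y, x) / 2))
  have hτ : ∀ k y x, |(τ k y x : ℝ) - τ (k + 1) y x| < mesh D H (y, x) := fun k y x => by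
    refine (Set.abs_projIcc_sub_projIcc zero_le_one).trans_lt ?_
    have := hpos (y, x)
    push_cast
    rw [show (k : ℝ) * (mesh D H (y, x) / 2) - (k + 1) * (mesh D H (y, x) / 2) =
      -(mesh D H (y, x) / 2) by ring, abs_neg, abs_of_pos (by linarith)]
    linarith
  refine ⟨fun k y x => H x (τ k y x), fun k => ?_, fun y x => ?_, fun y x => ?_, fun k y x =>
    ⟨dist_lt_of_lt_mesh (p := (y, x)) (hτ k y x), dist_lt_of_lt_mesh (p := (y, x)) ?_⟩⟩
  · have : Continuous fun p : Y × X => τ k p.1 p.2 :=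
      continuous_projIcc.comp (continuous_const.mul (hm.div_const 2))
    exact hH.comp (continuous_snd.prodMk this)
  · have : τ 0 y x = 0 := by simp [τ]
    simp only [this, h0]
  -- Nearby meshes exceed half of this one, so `M` steps of half a nearby mesh cover length at least
  -- 1.
  · obtain ⟨M, hM⟩ := exists_nat_gt (4 / mesh D H (y, x))
    refine ⟨M, ?_⟩
    have h2 : mesh D H (y, x) / 2 < mesh D H (y, x) := by linarith [hpos (y, x)]
    filter_upwards [hm.continuousAt.eventually (lt_mem_nhds h2)] with q hq k hk
    have hτ1 : τ k q.1 q.2 = 1 := by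
      refine Set.projIcc_of_right_le _ ?_
      have hk' : (M : ℝ) ≤ k := by exact_mod_cast hk
      rw [div_lt_iff₀ (hpos _)] at hM
      change 1 ≤ (k : ℝ) * (mesh D H q / 2)
      have := hpos (y, x)
      nlinarith
    simp only [hτ1, h1]
  · rw [abs_sub_comm]
    exact hτ k y x

theorem bddAbove_of_eventually_const {s : ℕ → ℝ} {M : ℕ} (h : ∀ k, M ≤ k → s k = s M) :
    BddAbove (Set.range s) := by
  refine ⟨(Finset.range (M + 1)).sup' ⟨M, by simp⟩ s, ?_⟩
  rintro _ ⟨k, rfl⟩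
  rcases le_total M k with hk | hk
  · rw [h k hk]; exact Finset.le_sup' s (by simp)
  · exact Finset.le_sup' s (by simp; omega)

theorem iSup_eq_sup' {s : ℕ → ℝ} {M : ℕ} (h : ∀ k, M ≤ k → s k = s M) :
    ⨆ k, s k = (Finset.range (M + 1)).sup' ⟨M, by simp⟩ s := by
  refine le_antisymm (ciSup_le fun k => ?_)
    (Finset.sup'_le _ _ fun k _ => le_ciSup (bddAbove_of_eventually_const h) k)
  rcases le_total M k with hk | hk
  · rw [h k hk]; exact Finset.le_sup' s (by simp)
  · exact Finset.le_sup' s (by simp; omega)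

variable {h : ℕ → Y → X → X}

theorem exists_forall_steps_eq
    (hs : ∀ y x, ∃ M, ∀ᶠ q in 𝓝 (y, x), ∀ k, M ≤ k → h k q.1 q.2 = q.2) (y : Y) (l : List X) :
    ∃ M, ∀ᶠ q in 𝓝 (y, l), ∀ x ∈ q.2, ∀ k, M ≤ k → h k q.1 x = x := by
  choose M hM using hs
  obtain ⟨N, hN⟩ := ((l.finite_toSet.image (M y)).bddAbove)
  refine ⟨N, eventually_forall_mem
    (P := fun y x => ∀ k, N ≤ k → h k y x = x) fun x hx => ?_⟩
  filter_upwards [hM y x] with q hq k hk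
  exact hq k ((hN ⟨x, hx, rfl⟩).trans hk)

/-- The supremum over all steps of the pulled back pseudometrics. -/
theorem isPMetricFamily_iSup (hD : IsPMetricFamily D)
    (hc : ∀ k, Continuous fun p : Y × X => h k p.1 p.2)
    (hs : ∀ y x, ∃ M, ∀ᶠ q in 𝓝 (y, x), ∀ k, M ≤ k → h k q.1 q.2 = q.2) :
    IsPMetricFamily (fun y a b => ⨆ k, 3 * D y (h k y a) (h k y b)) ∧
      ∀ k y a b, 3 * D y (h k y a) (h k y b) ≤ ⨆ k, 3 * D y (h k y a) (h k y b) := by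
  -- Locally the sequence is eventually constant, so the supremum is a finite maximum there and is
  -- continuous.
  have hev : ∀ y a b, ∃ M, ∀ᶠ q : Y × X × X in 𝓝 (y, a, b), ∀ k, M ≤ k →
      3 * D q.1 (h k q.1 q.2.1) (h k q.1 q.2.2) =
        3 * D q.1 (h M q.1 q.2.1) (h M q.1 q.2.2) := fun y a b => by
    obtain ⟨M, hM⟩ := hs y a
    obtain ⟨N, hN⟩ := hs y b
    refine ⟨max M N, ?_⟩
    have h1 : Tendsto (fun q : Y × X × X => (q.1, q.2.1)) (𝓝 (y, a, b)) (𝓝 (y, a)) :=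
      Continuous.continuousAt (by fun_prop)
    have h2 : Tendsto (fun q : Y × X × X => (q.1, q.2.2)) (𝓝 (y, a, b)) (𝓝 (y, b)) :=
      Continuous.continuousAt (by fun_prop)
    filter_upwards [h1.eventually hM, h2.eventually hN] with q hq1 hq2 k hk
    rw [hq1 k (le_trans (le_max_left _ _) hk), hq2 k (le_trans (le_max_right _ _) hk),
      hq1 _ (le_max_left _ _), hq2 _ (le_max_right _ _)]
  have hbdd : ∀ y a b, BddAbove (Set.range fun k => 3 * D y (h k y a) (h k y b)) :=
    fun y a b => by
      obtain ⟨M, hM⟩ := hev y a b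
      exact bddAbove_of_eventually_const hM.self_of_nhds
  have hle := fun k y a b => le_ciSup (hbdd y a b) k
  refine ⟨⟨?_, fun y a => ?_, fun y a b => ?_, fun y a b c => ciSup_le fun k => ?_⟩, hle⟩
  · refine continuous_iff_continuousAt.2 fun ⟨y, a, b⟩ => ?_
    obtain ⟨M, hM⟩ := hev y a b
    refine ContinuousAt.congr (f := fun q : Y × X × X => (Finset.range (M + 1)).sup'
      ⟨M, by simp⟩ fun k => 3 * D q.1 (h k q.1 q.2.1) (h k q.1 q.2.2)) ?_ ?_
    · refine ContinuousAt.finset_sup'_apply _ fun k _ => Continuous.continuousAt ?_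
      have h1 : Continuous fun q : Y × X × X => h k q.1 q.2.1 :=
        (hc k).comp (f := fun q : Y × X × X => (q.1, q.2.1)) (by fun_prop)
      have h2 : Continuous fun q : Y × X × X => h k q.1 q.2.2 :=
        (hc k).comp (f := fun q : Y × X × X => (q.1, q.2.2)) (by fun_prop)
      exact continuous_const.mul (hD.cont.comp (f := fun q : Y × X × X =>
        (q.1, h k q.1 q.2.1, h k q.1 q.2.2)) (by fun_prop))
    · filter_upwards [hM] with q hq
      exact (iSup_eq_sup' hq).symm
  · simp [hD.self]
  · exact le_trans (mul_nonneg (by norm_num) (hD.nonneg y (h 0 y a) (h 0 y b))) (hle 0 y a b)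
  · have := hD.triangle y (h k y a) (h k y b) (h k y c)
    linarith [hle k y a b, hle k y b c]

end Steps

variable {V : Type v} [AddCommGroup V] [TopologicalSpace V] [IsTopologicalAddGroup V]

/-- On a contractible space, numerably continuous parametrized cocycles are coboundaries of
numerably continuous cochains. -/
theorem exists_numerablyContinuous_primitive [ContractibleSpace X] {F : Y → List X → V}
    (hF : NumerablyContinuous F) (hdF : ∀ y l, listD (F y) l = 0) :
    ∃ g : Y → List X → V, NumerablyContinuous g ∧ ∀ y l, listD (g y) l = F y l := by
  obtain ⟨D, hD, hDF⟩ := hF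
  obtain ⟨b, ⟨K⟩⟩ := id_nullhomotopic X
  -- `K` runs from the identity to the constant map; `σ` reverses it.
  obtain ⟨h, hc, h0, hs, hstep⟩ := exists_steps (D := D) (H := fun x t => K (σ t, x)) hD
    (by fun_prop) (b := b) (by simp) (by simp)
  obtain ⟨hD', hle⟩ := isPMetricFamily_iSup hD hc hs
  have hex : ∀ y (l : List X), ∃ M, ∀ x ∈ l, ∀ k, M ≤ k → h k y x = x := fun y l => by
    obtain ⟨M, hM⟩ := exists_forall_steps_eq hs y l
    exact ⟨M, hM.self_of_nhds⟩
  choose N hN using hex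
  have hN' : ∀ y l M, (∀ x ∈ l, ∀ k, M ≤ k → h k y x = x) →
      prismSum (fun k => h k y) (F y) (N y l) l = prismSum (fun k => h k y) (F y) M l :=
    fun y l M hM => by
      rw [← prismSum_eq_of_le (F y) (le_max_left (N y l) M) fun k hk x hx => hN y l x hx k hk,
        ← prismSum_eq_of_le (F y) (le_max_right (N y l) M) fun k hk x hx => hM x hx k hk]
  refine ⟨fun y l => prismSum (fun k => h k y) (F y) (N y l) l + F y (b :: l.map fun _ => b),
    ⟨_, hD', fun y l hl => ?_⟩, fun y l => ?_⟩
  -- This is the purpose of the factor 3: adding one step of length below `1/3` keeps all prism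
  -- vertices within distance 1.
  · have hl' : ∀ k, ∀ x ∈ l, ∀ x' ∈ l, D y (h k y x) (h k y x') < 1 / 3 :=
      fun k x hx x' hx' => by linarith [hle k y x x', hl x hx x' hx']
    obtain ⟨M, hM⟩ := exists_forall_steps_eq hs y l
    refine ContinuousAt.congr (f := fun p : Y × List X =>
      prismSum (fun k => h k p.1) (F p.1) M p.2 + F p.1 (b :: p.2.map fun _ => b)) ?_ ?_
    · refine ContinuousAt.add (tendsto_finsetSum _ fun k _ => ContinuousAt.sub ?_ ?_) ?_
      · refine continuousAt_prism (hc k) (hc (k + 1)) fun m hm => hDF y m fun z hz z' hz' => ?_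
        obtain ⟨x, hx, hzx⟩ := hm z hz
        obtain ⟨x', hx', hzx'⟩ := hm z' hz'
        have e1 := hl' k x hx x' hx'
        have e2 := hl' (k + 1) x hx x' hx'
        have e3 := hstep k y x
        rcases hzx with rfl | rfl <;> rcases hzx' with rfl | rfl
        · linarith
        · linarith [hD.triangle y (h k y x) (h (k + 1) y x) (h (k + 1) y x')]
        · linarith [hD.triangle y (h (k + 1) y x) (h k y x) (h k y x')]
        · linarith
      -- The original tuple is itself small, since `h M` fixes its entries.
      · refine continuousAt_prism (a := fun _ => id) (b := fun _ => id) continuous_snd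
          continuous_snd fun m hm => hDF y m fun z hz z' hz' => ?_
        obtain ⟨x, hx, hzx⟩ := hm z hz
        obtain ⟨x', hx', hzx'⟩ := hm z' hz'
        have hzx : z = x := hzx.elim id id
        have hzx' : z' = x' := hzx'.elim id id
        have e := hl' M x hx x' hx'
        rw [hM.self_of_nhds x hx M le_rfl, hM.self_of_nhds x' hx' M le_rfl] at e
        rw [hzx, hzx']
        linarith
      · refine (continuousAt_comp (f := fun p : Y × List X => (p.1, b :: p.2.map fun _ => b))
          (y, l) (hDF y (b :: l.map fun _ => b) fun z hz z' hz' => ?_) (by fun_prop) rfl :)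
        have hb : ∀ z ∈ b :: l.map fun _ => b, z = b := by simp +contextual
        rw [hb z hz, hb z' hz', hD.self]
        exact one_pos
    · filter_upwards [hM] with p hp
      rw [hN' p.1 p.2 M hp]
  · rw [listD_add, listD_cone b (hdF y)]
    -- A bound valid for `l` is valid for all its faces, so a single one serves throughout the
    -- differential.
    have e : listD (fun m => prismSum (fun k => h k y) (F y) (N y m) m) l =
        listD (prismSum (fun k => h k y) (F y) (N y l)) l :=
      listD_congr fun m _ hm => hN' y m _ fun x hx => hN y l x (hm.subset hx)
    rw [e, listD_prismSum _ (hdF y), List.map_congr_left (g := id)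
      (fun x hx => hN y l x hx _ le_rfl), List.map_congr_left (g := fun _ => b)
      (fun x _ => h0 y x)]
    simp

end Numerable

end EqCoh

namespace EqCoh

open Filter Topology Uniformity

/-! ### Pseudometrics from entourages -/

/-- Successive refinements of `W` by halved symmetric entourages generate a coarser, countably
generated uniformity, which is pseudometrizable. -/
theorem exists_pseudometric_of_mem_uniformity {α : Type u} [UniformSpace α] {W : Set (α × α)}
    (hW : W ∈ 𝓤 α) :
    ∃ (m : PseudoMetricSpace α), (∀ s ∈ @uniformity α m.toUniformSpace, s ∈ 𝓤 α) ∧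
      ∃ ε > 0, ∀ a b, @dist α m.toDist a b < ε → (a, b) ∈ W := by
  have step : ∀ V : {V : Set (α × α) // V ∈ 𝓤 α}, ∃ V' : {V : Set (α × α) // V ∈ 𝓤 α},
      (∀ a b, (a, b) ∈ V'.1 → (b, a) ∈ V.1) ∧
      (∀ a b c, (a, b) ∈ V'.1 → (b, c) ∈ V'.1 → (a, c) ∈ V.1) ∧ V'.1 ⊆ V.1 := fun ⟨V, hV⟩ => by
    obtain ⟨t, ht, hsymm, htV⟩ := comp_symm_mem_uniformity_sets hV
    have h2 : ∀ a b c, (a, b) ∈ t → (b, c) ∈ t → (a, c) ∈ V := fun a b c hab hbc =>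
      htV ⟨b, hab, hbc⟩
    have h3 : t ⊆ V := fun p hp => h2 p.1 p.1 p.2 (refl_mem_uniformity ht) hp
    exact ⟨⟨t, ht⟩, fun a b hab => h3 (hsymm.symm _ _ hab), h2, h3⟩
  choose next hn1 hn2 hn3 using step
  let V : ℕ → {V : Set (α × α) // V ∈ 𝓤 α} := fun n => next^[n] ⟨W, hW⟩
  have hV : ∀ n, V (n + 1) = next (V n) := fun n => Function.iterate_succ_apply' _ _ _
  have hanti : Antitone fun n => (V n).1 := antitone_nat_of_succ_le fun n => by
    change (V (n + 1)).1 ⊆ (V n).1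
    rw [hV]; exact hn3 _
  let 𝓕 : Filter (α × α) := ⨅ n, 𝓟 (V n).1
  have hbasis : 𝓕.HasAntitoneBasis fun n => (V n).1 := HasAntitoneBasis.iInf_principal hanti
  let c : UniformSpace.Core α := UniformSpace.Core.mk 𝓕
    (fun s hs => by
      obtain ⟨n, hn⟩ := hbasis.mem_iff.1 hs
      rintro ⟨a, b⟩ hp
      obtain rfl : a = b := hp
      exact hn (refl_mem_uniformity (V n).2))
    (by
      refine (hbasis.tendsto_iff hbasis.toHasBasis).2 fun n _ => ⟨n + 1, trivial, fun p hp => ?_⟩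
      rw [hV] at hp
      exact hn1 _ _ _ hp)
    (by
      intro s hs
      obtain ⟨n, hn⟩ := hbasis.mem_iff.1 hs
      refine (mem_lift'_sets ?_).2 ⟨(V (n + 1)).1, hbasis.mem _, ?_⟩
      · intro s t hst p ⟨z, h1, h2⟩
        exact ⟨z, hst h1, hst h2⟩
      · rintro p ⟨z, h1, h2⟩
        rw [hV] at h1 h2
        exact hn (hn2 _ _ _ _ h1 h2))
  let U : UniformSpace α := UniformSpace.ofCore c
  have hU : @uniformity α U = 𝓕 := rfl
  have : IsCountablyGenerated (@uniformity α U) := hbasis.isCountablyGenerated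
  obtain ⟨m, hm⟩ := @UniformSpace.metrizable_uniformity α U _
  refine ⟨m, fun s hs => ?_, ?_⟩
  · rw [hm] at hs
    obtain ⟨n, hn⟩ := hbasis.mem_iff.1 hs
    exact mem_of_superset (V n).2 hn
  · have h0 : W ∈ @uniformity α m.toUniformSpace := by
      rw [hm]
      exact hbasis.mem 0
    obtain ⟨ε, hε, h⟩ := (@Metric.mem_uniformity_dist α m W).1 h0
    exact ⟨ε, hε, fun a b hab => h hab⟩

theorem exists_continuous_pseudometric {G : Type u} [Group G] [TopologicalSpace G]
    [IsTopologicalGroup G] {W : Set G} (hW : W ∈ 𝓝 (1 : G)) :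
    ∃ d : G → G → ℝ, (Continuous fun p : G × G => d p.1 p.2) ∧ (∀ a, d a a = 0) ∧
      (∀ a b, 0 ≤ d a b) ∧ (∀ a b c, d a c ≤ d a b + d b c) ∧
      ∀ a b, d a b < 1 → a⁻¹ * b ∈ W := by
  let _ := IsTopologicalGroup.leftUniformSpace G
  obtain ⟨m, hm, ε, hε, hd⟩ := exists_pseudometric_of_mem_uniformity
    (α := G) (W := (fun p : G × G => p.1⁻¹ * p.2) ⁻¹' W) (preimage_mem_comap hW)
  have hc : @Continuous G G _ m.toUniformSpace.toTopologicalSpace id :=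
    @UniformContinuous.continuous G G _ m.toUniformSpace id fun s hs => hm s hs
  have hdist : Continuous fun p : G × G => @dist G m.toDist p.1 p.2 := by
    have h1 : @Continuous (G × G) G _ m.toUniformSpace.toTopologicalSpace fun p => p.1 :=
      @Continuous.comp (G × G) G G _ _ m.toUniformSpace.toTopologicalSpace Prod.fst id hc
        continuous_fst
    have h2 : @Continuous (G × G) G _ m.toUniformSpace.toTopologicalSpace fun p => p.2 :=
      @Continuous.comp (G × G) G G _ _ m.toUniformSpace.toTopologicalSpace Prod.snd id hc
        continuous_snd
    exact @Continuous.dist G (G × G) m _ _ _ h1 h2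
  refine ⟨fun a b => @dist G m.toDist a b / ε, hdist.div_const ε, fun a => ?_, fun a b => ?_,
    fun a b c => ?_, fun a b h => hd a b ?_⟩
  · change @dist G m.toDist a a / ε = 0
    rw [@dist_self G m, zero_div]
  · exact div_nonneg (@dist_nonneg G m _ _) hε.le
  · change @dist G m.toDist a c / ε ≤ @dist G m.toDist a b / ε + @dist G m.toDist b c / ε
    rw [← add_div]
    exact div_le_div_of_nonneg_right (@dist_triangle G m _ _ _) hε.le
  · rwa [div_lt_one hε] at h

end EqCoh

namespace EqCoh

open Filter Topology

section Basic

variable {X Y : Type u} [TopologicalSpace X] [TopologicalSpace Y] {V : Type v} [TopologicalSpace V]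

theorem eventually_length_fst (l : List X) (y : Y) :
    ∀ᶠ q in 𝓝 (l, y), q.1.length = l.length :=
  Tendsto.eventually (continuous_fst.continuousAt (x := (l, y))) (eventually_length_eq l)

theorem IsPMetricFamily.comap {X' Y' : Type u} [TopologicalSpace X'] [TopologicalSpace Y']
    {D : Y → X → X → ℝ} (h : IsPMetricFamily D) {φ : Y' → Y} (hφ : Continuous φ)
    {ψ : Y' → X' → X} (hψ : Continuous fun p : Y' × X' => ψ p.1 p.2) :
    IsPMetricFamily fun y a b => D (φ y) (ψ y a) (ψ y b) where
  cont := by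
    have h1 : Continuous fun p : Y' × X' × X' => ψ p.1 p.2.1 :=
      hψ.comp (f := fun p : Y' × X' × X' => (p.1, p.2.1)) (by fun_prop)
    have h2 : Continuous fun p : Y' × X' × X' => ψ p.1 p.2.2 :=
      hψ.comp (f := fun p : Y' × X' × X' => (p.1, p.2.2)) (by fun_prop)
    exact h.cont.comp (f := fun p : Y' × X' × X' => (φ p.1, ψ p.1 p.2.1, ψ p.1 p.2.2))
      (by fun_prop)
  self _ _ := h.self _ _
  nonneg _ _ _ := h.nonneg _ _ _
  triangle _ _ _ _ := h.triangle _ _ _ _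

theorem NumerablyContinuous.of_continuous {F : Y → List X → V}
    (h : Continuous fun p : Y × List X => F p.1 p.2) : NumerablyContinuous F :=
  ⟨fun _ _ _ => 0, ⟨continuous_const, by simp, by simp, by simp⟩,
    fun _ _ _ => h.continuousAt⟩

theorem NumerablyContinuous.comap {Y' : Type u} [TopologicalSpace Y'] {F : Y → List X → V}
    (h : NumerablyContinuous F) {φ : Y' → Y} (hφ : Continuous φ) :
    NumerablyContinuous fun y l => F (φ y) l := by
  obtain ⟨D, hD, hF⟩ := h
  refine ⟨_, hD.comap hφ (ψ := fun _ x => x) continuous_snd, fun y l hl => ?_⟩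
  exact (continuousAt_comp (f := fun p : Y' × List X => (φ p.1, p.2)) (y, l) (hF (φ y) l hl)
    (by fun_prop) rfl :)

end Basic

/-! ### Operations preserving numerable continuity -/

section Closure

variable {X Y : Type u} [TopologicalSpace X] [TopologicalSpace Y]
  {V : Type v} [AddCommGroup V] [TopologicalSpace V] [IsTopologicalAddGroup V]

theorem IsPMetricFamily.add {D D' : Y → X → X → ℝ} (h : IsPMetricFamily D)
    (h' : IsPMetricFamily D') : IsPMetricFamily fun y a b => D y a b + D' y a b where
  cont := h.cont.add h'.cont
  self y a := by rw [h.self, h'.self, add_zero]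
  nonneg y a b := add_nonneg (h.nonneg y a b) (h'.nonneg y a b)
  triangle y a b c := by linarith [h.triangle y a b c, h'.triangle y a b c]

theorem NumerablyContinuous.sub {F F' : Y → List X → V} (h : NumerablyContinuous F)
    (h' : NumerablyContinuous F') : NumerablyContinuous fun y l => F y l - F' y l := by
  obtain ⟨D, hD, hF⟩ := h
  obtain ⟨D', hD', hF'⟩ := h'
  refine ⟨_, hD.add hD', fun y l hl => ContinuousAt.sub (hF y l fun a ha b hb => ?_)
    (hF' y l fun a ha b hb => ?_)⟩
  · linarith [hl a ha b hb, hD'.nonneg y a b]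
  · linarith [hl a ha b hb, hD.nonneg y a b]

/-- Multiplication by a locally constant sign, and extension by zero, in the parameter. -/
theorem NumerablyContinuous.zsmul_length {F : List X → List X → V} (h : NumerablyContinuous F)
    (c : ℕ → ℤ) : NumerablyContinuous fun xs ys => c xs.length • F xs ys := by
  obtain ⟨D, hD, hF⟩ := h
  refine ⟨D, hD, fun y l hl => ?_⟩
  refine ContinuousAt.congr (f := fun p : List X × List X => c y.length • F p.1 p.2)
    ((hF y l hl).fun_const_smul _) ?_
  filter_upwards [eventually_length_fst y l] with p hp
  rw [hp]

/-- The sum of the pullbacks of a family of pseudometrics along the faces. -/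
theorem IsPMetricFamily.sum_eraseIdx {D : List X → X → X → ℝ} (h : IsPMetricFamily D) :
    IsPMetricFamily fun (xs : List X) a b => ∑ i ∈ Finset.range xs.length, D (xs.eraseIdx i) a b where
  cont := by
    refine continuous_iff_continuousAt.2 fun ⟨xs, a, b⟩ => ?_
    refine ContinuousAt.congr (f := fun p : List X × X × X =>
      ∑ i ∈ Finset.range xs.length, D (p.1.eraseIdx i) p.2.1 p.2.2) ?_ ?_
    · refine tendsto_finsetSum _ fun i _ => Continuous.continuousAt ?_
      exact h.cont.comp (f := fun p : List X × X × X => (p.1.eraseIdx i, p.2))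
        ((List.continuous_eraseIdx.comp continuous_fst).prodMk continuous_snd)
    · filter_upwards [eventually_length_fst xs (a, b)] with p hp
      rw [hp]
  self _ _ := by simp [h.self]
  nonneg _ _ _ := Finset.sum_nonneg fun _ _ => h.nonneg _ _ _
  triangle _ _ _ _ := by
    rw [← Finset.sum_add_distrib]
    exact Finset.sum_le_sum fun _ _ => h.triangle _ _ _ _

/-- Deleting an entry of `xs` changes the parameter, so the pseudometric at `xs` must dominate those
at all its faces. -/
theorem NumerablyContinuous.listD_left {F : List X → List X → V} (h : NumerablyContinuous F) :
    NumerablyContinuous fun xs ys => listD (fun m => F m ys) xs := by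
  obtain ⟨D, hD, hF⟩ := h
  refine ⟨_, hD.sum_eraseIdx, fun xs ys hl => ?_⟩
  refine (continuousAt_comp (f := Prod.swap) (xs, ys) (continuousAt_listD (l := xs) (y := ys)
    (F := fun ys m => F m ys) fun i hi => ?_) continuous_swap rfl :)
  refine (continuousAt_comp (f := Prod.swap) (ys, xs.eraseIdx i)
    (hF (xs.eraseIdx i) ys fun a ha b hb => ?_) continuous_swap rfl :)
  exact (Finset.single_le_sum (f := fun i => D (xs.eraseIdx i) a b)
    (fun i _ => hD.nonneg _ a b) (Finset.mem_range.2 hi)).trans_lt (hl a ha b hb)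

end Closure

/-! ### The zigzag in the double complex -/

section ZigZag

variable {G : Type u} {V : Type v} [AddCommGroup V]

/-- The cocycle to be killed in the next step of the zigzag. -/
def zigzagRemainder (c : List G → V) (g : List G → List G → V) (xs ys : List G) : V :=
  (-1 : ℤ) ^ xs.length • (c (xs ++ ys) - listD (fun m => g m ys) xs)

/-- Inserting the equation for the faces of `xs` and using that the left differential squares to
zero leaves the two partial differentials of `c (xs ++ ys)`, which cancel by `listD_append`. -/
theorem listD_zigzagRemainder {c : List G → V} (hc : ∀ l, listD c l = 0)
    {g : List G → List G → V} {xs : List G}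
    (hg : ∀ m ys, m.length + 1 = xs.length →
      listD (fun m' => g m' ys) m + (-1 : ℤ) ^ m.length • listD (g m) ys = c (m ++ ys))
    (hxs : xs ≠ []) (ys : List G) : listD (zigzagRemainder c g xs) ys = 0 := by
  obtain ⟨p, hp⟩ : ∃ p, xs.length = p + 1 :=
    ⟨xs.length - 1, by have := List.length_pos_iff.2 hxs; omega⟩
  have h1 : listD (fun m => listD (g m) ys) xs =
      (-1 : ℤ) ^ p • listD (fun m => c (m ++ ys)) xs := by
    have : listD (fun m => listD (g m) ys) xs =
        listD (fun m => (-1 : ℤ) ^ p • (c (m ++ ys) - listD (fun m' => g m' ys) m)) xs := by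
      refine listD_congr fun m hm _ => ?_
      have hmp : m.length = p := by omega
      rw [← hg m ys hm, hmp, add_sub_cancel_left, smul_smul, ← mul_pow]
      simp
    rw [this, listD_zsmul, listD_sub]
    congr 1
    exact (sub_eq_self).2 (listD_listD (fun m => g m ys) xs)
  have h2 := listD_append c xs ys
  rw [hc, hp, pow_succ] at h2
  change listD (fun ys => (-1 : ℤ) ^ xs.length • (c (xs ++ ys) - listD (fun m => g m ys) xs)) ys = 0
  rw [listD_zsmul, listD_sub, ← listD_comm, h1]
  have h3 : listD (fun m => c (m ++ ys)) xs = (-1 : ℤ) ^ p • listD (fun m => c (xs ++ m)) ys := by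
    rw [mul_neg_one, neg_smul, ← sub_eq_add_neg, eq_comm, sub_eq_zero] at h2
    exact h2
  rw [h3, smul_smul, ← mul_pow]
  simp

variable [Group G] [DistribMulAction G V]

theorem listD_equivariant {F : List G → V} {F' : List G → V} {h : G}
    (hF : ∀ m, F (m.map (h * ·)) = h • F' m) (l : List G) :
    listD F (l.map (h * ·)) = h • listD F' l := by
  rw [← listD_map]
  simp only [hF]
  exact (map_listD (DistribSMul.toAddMonoidHom V h) F' l).symm

theorem zigzagRemainder_equivariant {c : List G → V} {g : List G → List G → V}
    (hc : ∀ (h : G) l, c (l.map (h * ·)) = h • c l)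
    (hg : ∀ (h : G) xs ys, g (xs.map (h * ·)) (ys.map (h * ·)) = h • g xs ys)
    (h : G) (xs ys : List G) : zigzagRemainder c g (xs.map (h * ·)) (ys.map (h * ·)) =
      h • zigzagRemainder c g xs ys := by
  simp only [zigzagRemainder, List.length_map]
  rw [← List.map_append, hc, listD_equivariant (fun m => hg h m ys), ← smul_sub, smul_comm]

variable [TopologicalSpace G] [IsTopologicalGroup G] [ContractibleSpace G]
  [TopologicalSpace V] [IsTopologicalAddGroup V] [ContinuousSMul G V]

theorem exists_zigzag {f : List G → V} (hf : NumerablyContinuous fun _ : List G => f)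
    (hfe : ∀ (h : G) l, f (l.map (h * ·)) = h • f l) (hdf : Continuous (listD f)) (p : ℕ) :
    ∃ g : List G → List G → V, NumerablyContinuous g ∧ g [] = f ∧
      (∀ (h : G) xs ys, g (xs.map (h * ·)) (ys.map (h * ·)) = h • g xs ys) ∧
      ∀ xs ys, xs.length ≤ p →
        listD (fun m => g m ys) xs + (-1 : ℤ) ^ xs.length • listD (g xs) ys =
          listD f (xs ++ ys) := by
  induction p with
  | zero =>
    refine ⟨fun _ => f, hf, rfl, fun h _ ys => hfe h ys, fun xs ys hxs => ?_⟩
    obtain rfl : xs = [] := List.length_eq_zero_iff.1 (by omega)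
    simp
  | succ p ih =>
    obtain ⟨g, hgc, hg0, hge, hg⟩ := ih
    set c := listD f with hcdef
    have hce : ∀ (h : G) l, c (l.map (h * ·)) = h • c l := fun h => listD_equivariant (hfe h)
    have hR : NumerablyContinuous (zigzagRemainder c g) :=
      ((NumerablyContinuous.of_continuous (hdf.comp continuous_append)).sub
        hgc.listD_left).zsmul_length fun n => (-1) ^ n
    -- The remainder is known to be a cocycle only for `|1 :: t| = p + 1`; other lengths are set to
    -- zero, which stays continuous as length is locally constant.
    obtain ⟨P, ⟨D₀, hD₀, hP⟩, hdP⟩ := exists_numerablyContinuous_primitive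
      (F := fun t ys => (if t.length = p then (1 : ℤ) else 0) • zigzagRemainder c g (1 :: t) ys)
      ((hR.comap (φ := fun t => 1 :: t) (by fun_prop)).zsmul_length
        fun n => if n = p then 1 else 0) (fun t ys => by
          rw [listD_zsmul]
          by_cases ht : t.length = p
          · rw [listD_zigzagRemainder (fun l => listD_listD f l)
              (fun m ys hm => hg m ys (by simp at hm; omega)) (by simp), smul_zero]
          · simp [ht])
    obtain ⟨D, hD, hgD⟩ := hgc
    let x : List G → G := fun xs => xs.getD 0 1
    have hx : Continuous x := continuous_getD 1 0
    let t : List G → List G := fun xs => xs.eraseIdx 0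
    have ht : Continuous t := List.continuous_eraseIdx
    have hφ : Continuous fun xs => (t xs).map ((x xs)⁻¹ * ·) := by fun_prop
    have hq : Continuous fun q : List G × List G => q.2.map ((x q.1)⁻¹ * ·) := by fun_prop
    -- Rows of length at most `p` are kept; beyond, the values at head 1 are translated by the head.
    -- The default 1 in `x` is never used there, since those lists are nonempty.
    refine ⟨fun xs ys => if xs.length ≤ p then g xs ys else
      x xs • P ((t xs).map ((x xs)⁻¹ * ·)) (ys.map ((x xs)⁻¹ * ·)), ⟨_, hD.add (hD₀.comap hφ
        (ψ := fun xs a => (x xs)⁻¹ * a) (by fun_prop)), fun xs ys hl => ?_⟩, by simpa using hg0,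
        fun h xs ys => ?_, fun xs ys hxs => ?_⟩
    · have hlen : ∀ᶠ q in 𝓝 (xs, ys), q.1.length = xs.length :=
        eventually_length_fst xs ys
      by_cases hxs : xs.length ≤ p
      · refine ContinuousAt.congr (f := fun q : List G × List G => g q.1 q.2)
          (hgD xs ys fun a ha b hb => ?_) ?_
        · linarith [hl a ha b hb, hD₀.nonneg ((t xs).map ((x xs)⁻¹ * ·)) ((x xs)⁻¹ * a)
            ((x xs)⁻¹ * b)]
        · filter_upwards [hlen] with q hq
          rw [if_pos (hq ▸ hxs)]
      · refine ContinuousAt.congr (f := fun q : List G × List G => x q.1 •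
          P ((t q.1).map ((x q.1)⁻¹ * ·)) (q.2.map ((x q.1)⁻¹ * ·))) ?_ ?_
        · refine ContinuousAt.smul (hx.comp continuous_fst).continuousAt ?_
          refine (continuousAt_comp (f := fun q : List G × List G =>
            ((t q.1).map ((x q.1)⁻¹ * ·), q.2.map ((x q.1)⁻¹ * ·))) (xs, ys)
            (hP _ _ fun a' ha' b' hb' => ?_) ((hφ.comp continuous_fst).prodMk hq) rfl :)
          obtain ⟨a, ha, rfl⟩ := List.mem_map.1 ha'
          obtain ⟨b, hb, rfl⟩ := List.mem_map.1 hb'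
          linarith [hl a ha b hb, hD.nonneg xs a b]
        · filter_upwards [hlen] with q hq
          rw [if_neg (hq ▸ hxs)]
    · simp only [List.length_map]
      split_ifs with hxs
      · exact hge h xs ys
      · cases xs with
        | nil => simp at hxs
        | cons a xs => simp [x, t, Function.comp_def, mul_assoc, mul_smul]
    · have hfst : listD (fun m => if m.length ≤ p then g m ys else
          x m • P ((t m).map ((x m)⁻¹ * ·)) (ys.map ((x m)⁻¹ * ·))) xs =
            listD (fun m => g m ys) xs :=
        listD_congr fun m hm _ => if_pos (by omega)
      rw [hfst]
      by_cases hxs' : xs.length ≤ p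
      · simp only [if_pos hxs']
        exact hg xs ys hxs'
      · simp only [if_neg hxs']
        cases xs with
        | nil => simp at hxs'
        | cons a xs =>
          have hlen : xs.length = p := by simp at hxs hxs'; omega
          have hR' := zigzagRemainder_equivariant hce hge a⁻¹ (a :: xs) ys
          have e : listD (fun ys => a • P (xs.map (a⁻¹ * ·)) (ys.map (a⁻¹ * ·))) ys =
              zigzagRemainder c g (a :: xs) ys := by
            have e1 := map_listD (DistribSMul.toAddMonoidHom V a)
              (fun ys => P (xs.map (a⁻¹ * ·)) (ys.map (a⁻¹ * ·))) ys
            rw [listD_map (a⁻¹ * ·) (P (xs.map (a⁻¹ * ·))), hdP] at e1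
            rw [List.map_cons, inv_mul_cancel] at hR'
            rw [List.length_map, if_pos hlen, one_smul, hR'] at e1
            simpa using e1.symm
          change listD (fun m => g m ys) (a :: xs) + (-1 : ℤ) ^ (a :: xs).length •
            listD (fun ys => a • P (xs.map (a⁻¹ * ·)) (ys.map (a⁻¹ * ·))) ys = _
          rw [e, zigzagRemainder, smul_smul, ← mul_pow]
          simp

end ZigZag

end EqCoh

namespace EqCoh

open Filter Topology

/-! ### The correcting cochain -/

section Correction

variable {G : Type u} {V : Type v} [AddCommGroup V] [Group G] [DistribMulAction G V]

theorem alexanderWhitney_equivariant {B B' : List G → List G → V} {h : G}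
    (hB : ∀ xs ys, B (xs.map (h * ·)) (ys.map (h * ·)) = h • B' xs ys) (l : List G) :
    alexanderWhitney B (l.map (h * ·)) = h • alexanderWhitney B' l := by
  induction l generalizing B B' with
  | nil => simp
  | cons x l ih =>
    rw [List.map_cons, alexanderWhitney_cons, alexanderWhitney_cons, smul_add,
      ih fun xs ys => hB (x :: xs) ys]
    congr 1
    exact hB [x] (x :: l)

variable [TopologicalSpace G] [IsTopologicalGroup G] [ContractibleSpace G]
  [TopologicalSpace V] [IsTopologicalAddGroup V] [ContinuousSMul G V]

/-- Up to a coboundary, an equivariant cochain with continuous coboundary is continuous. -/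
theorem exists_correction {f : List G → V} (hf : NumerablyContinuous fun _ : List G => f)
    (hfe : ∀ (h : G) l, f (l.map (h * ·)) = h • f l) (hdf : Continuous (listD f)) (p : ℕ) :
    ∃ e : List G → V, (∀ (h : G) l, e (l.map (h * ·)) = h • e l) ∧
      (∀ (x : G) (n : ℕ), ∀ᶠ z in 𝓝 (fun _ : Fin n => x), ContinuousAt e (List.ofFn z)) ∧
      ∀ l : List G, l.length ≤ p → ContinuousAt (fun l => f l + listD e l) l := by
  obtain ⟨g, hgc, hg0, hge, hg⟩ := exists_zigzag hf hfe hdf p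
  let B : List G → List G → V := fun xs ys => (-1 : ℤ) ^ xs.length • g xs ys
  obtain ⟨D, hD, hDB⟩ : NumerablyContinuous B := hgc.zsmul_length fun n => (-1) ^ n
  let C : List G → List G → V := fun xs ys => (-1 : ℤ) ^ xs.length • listD f (xs ++ ys)
  have hlen : ∀ q : List G × List G, ∀ᶠ q' in 𝓝 q, q'.1.length = q.1.length :=
    fun q => eventually_length_fst q.1 q.2
  have hC : Continuous fun q : List G × List G => C q.1 q.2 := by
    refine continuous_iff_continuousAt.2 fun q => ?_
    refine ContinuousAt.congr (f := fun q' : List G × List G =>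
      (-1 : ℤ) ^ q.1.length • listD f (q'.1 ++ q'.2))
      (((hdf.comp continuous_append).fun_const_smul _).continuousAt) ?_
    filter_upwards [hlen q] with q' hq'
    simp only [C, hq']
  have hAW : ∀ {B : List G → List G → V} {l : List G}, (∀ s x t, l = s ++ x :: t →
      ContinuousAt (fun q : List G × List G => B q.1 q.2) (s ++ [x], x :: t)) →
      ContinuousAt (alexanderWhitney B) l := fun {B l} h =>
    (continuousAt_comp (f := fun l : List G => (PUnit.unit.{u + 1}, l)) l
      (continuousAt_alexanderWhitney (Y := PUnit.{u + 1}) (B := fun _ => B) (y := PUnit.unit)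
        fun s x t hl => (continuousAt_comp (f := Prod.snd)
          (PUnit.unit.{u + 1}, (s ++ [x], x :: t)) (h s x t hl) continuous_snd rfl :))
      (continuous_const.prodMk continuous_id) rfl :)
  have hfinal : ∀ l : List G, l.length ≤ p → f l + listD (alexanderWhitney B) l =
      (-1 : ℤ) ^ l.length • B l [] - alexanderWhitney C l := fun l hl => by
    have h1 : alexanderWhitney (totalD B) l = alexanderWhitney (fun xs ys => 0 - C xs ys) l := by
      refine alexanderWhitney_congr fun xs ys hxs => ?_
      have h2 : listD (fun m => B m ys) xs =
          listD (fun m => -((-1 : ℤ) ^ xs.length • g m ys)) xs := by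
        refine listD_congr fun m hm _ => ?_
        simp [B, ← hm, pow_succ]
      have h3 : listD (B xs) ys = (-1 : ℤ) ^ xs.length • listD (g xs) ys :=
        listD_zsmul _ (g xs) ys
      simp only [totalD, C]
      rw [h2, h3, listD_neg, listD_zsmul, ← hg xs ys (hxs.trans hl), smul_add]
      abel
    have h4 : alexanderWhitney (fun _ _ => (0 : V)) l = 0 := by
      simpa using alexanderWhitney_sub (fun _ _ => (0 : V)) (fun _ _ => 0) l
    have h5 := alexanderWhitney_totalD B l
    rw [h1, alexanderWhitney_sub, h4, zero_sub] at h5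
    have h6 : B [] l = f l := by simp [B, hg0]
    rw [h6] at h5
    rw [sub_eq_add_neg _ (alexanderWhitney C l), h5]
    abel
  refine ⟨alexanderWhitney B, fun h => alexanderWhitney_equivariant fun xs ys => ?_,
    fun x n => ?_, fun l hl => ?_⟩
  · simp only [B, List.length_map, hge]
    exact smul_comm _ _ _
  -- The Alexander–Whitney terms have as parameter a prefix of `z`. These finitely many open
  -- conditions hold on the diagonal, where all distances vanish.
  · have hev : ∀ᶠ z in 𝓝 (fun _ : Fin n => x), ∀ i j k : Fin n,
        D ((List.ofFn z).take (i + 1)) (z j) (z k) < 1 := by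
      simp only [eventually_all]
      intro i j k
      have hc : Continuous fun z : Fin n → G => D ((List.ofFn z).take (i + 1)) (z j) (z k) :=
        hD.cont.comp (f := fun z : Fin n → G => ((List.ofFn z).take (i + 1), z j, z k))
          (((continuous_take _).comp (continuous_ofFn n)).prodMk (by fun_prop))
      refine hc.continuousAt.eventually (gt_mem_nhds ?_)
      simp only [hD.self]
      exact one_pos
    filter_upwards [hev] with z hz
    refine hAW fun s y t hl => hDB _ _ fun a ha b hb => ?_
    have hmem : ∀ a ∈ y :: t, ∃ j, z j = a := fun a ha => by
      have : a ∈ List.ofFn z := hl ▸ List.mem_append_right s ha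
      simpa [List.mem_ofFn] using this
    obtain ⟨j, rfl⟩ := hmem a ha
    obtain ⟨k, rfl⟩ := hmem b hb
    have hs : s.length < n := by
      have := congrArg List.length hl
      simp at this
      omega
    have := hz ⟨s.length, hs⟩ j k
    rwa [hl, show s ++ y :: t = (s ++ [y]) ++ t by simp,
      List.take_left' (by simp)] at this
  · refine ContinuousAt.congr (f := fun m => (-1 : ℤ) ^ l.length • B m [] -
      alexanderWhitney C m) (ContinuousAt.sub ?_ (hAW fun s x t _ => hC.continuousAt)) ?_
    -- The second list is empty, so the smallness condition is vacuous and continuity holds at every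
    -- `l`.
    · refine ContinuousAt.fun_const_smul ?_ _
      exact (continuousAt_comp (f := fun m : List G => (m, ([] : List G))) l
        (hDB l [] (by simp)) (by fun_prop) rfl :)
    · filter_upwards [eventually_length_eq l] with m hm
      rw [hfinal m (hm ▸ hl), hm]

end Correction

section OfFn

variable {X : Type u}

theorem exists_eq_ofFn (l : List X) : ∃ x : Fin l.length → X, l = List.ofFn x :=
  ⟨l.get, (List.ofFn_get l).symm⟩

theorem getD_ofFn {n : ℕ} (x : Fin n → X) (i : Fin n) (a : X) : (List.ofFn x).getD i a = x i := by
  rw [List.getD_eq_getElem _ _ (by rw [List.length_ofFn]; exact i.2), List.getElem_ofFn]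

end OfFn

theorem isOpen_diagNhd {X : Type u} [TopologicalSpace X] {𝔘 : Set (Set X)} (h : IsOpenCovering 𝔘)
    (n : ℕ) : IsOpen (diagNhd 𝔘 n) := by
  refine isOpen_biUnion fun U hU => ?_
  simp only [Set.ofPred_forall]
  exact isOpen_iInter_of_finite fun i => (h.1 U hU).preimage (continuous_apply i)

/-! ### Passage between homogeneous cochains and cochains on lists -/

section Transfer

variable {G : Type u} {V : Type v} [AddCommGroup V] [Group G]

/-- The cochain on lists given by a homogeneous cochain. -/
noncomputable def toListCochain {n : ℕ} (f : Cochain G V n) (l : List G) : V :=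
  if l.length = n + 1 then f (fun i => l.getD i 1) else 0

theorem toListCochain_ofFn {n : ℕ} (f : Cochain G V n) (x : Fin (n + 1) → G) :
    toListCochain f (List.ofFn x) = f x := by
  rw [toListCochain, if_pos List.length_ofFn]
  simp only [getD_ofFn]

theorem toListCochain_of_ne {n : ℕ} (f : Cochain G V n) {l : List G} (hl : l.length ≠ n + 1) :
    toListCochain f l = 0 := if_neg hl

theorem listD_toListCochain {n : ℕ} (f : Cochain G V n) :
    listD (toListCochain f) = toListCochain (d G V n f) := by
  funext l
  obtain ⟨m, hm⟩ : ∃ m, l.length = m := ⟨_, rfl⟩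
  obtain ⟨x, hx⟩ := exists_eq_ofFn l
  generalize l.length = m' at hm x hx
  subst hx hm
  cases m' with
  | zero => simp [toListCochain]
  | succ m =>
    rw [listD_ofFn]
    by_cases hmn : m = n + 1
    · subst hmn
      simp only [toListCochain_ofFn, d_apply]
    · rw [toListCochain_of_ne _ (by simpa using hmn)]
      refine Finset.sum_eq_zero fun i _ => ?_
      rw [toListCochain_of_ne _ (by simpa using hmn), smul_zero]

theorem toListCochain_equivariant [DistribMulAction G V] {n : ℕ} {f : Cochain G V n}
    (hf : f ∈ eqCochains G G V n) (h : G) (l : List G) :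
    toListCochain f (l.map (h * ·)) = h • toListCochain f l := by
  by_cases hl : l.length = n + 1
  · obtain ⟨x, hx⟩ := exists_eq_ofFn l
    generalize l.length = m at hl x hx
    subst hl hx
    rw [List.map_ofFn, toListCochain_ofFn, toListCochain_ofFn]
    exact hf h x
  · rw [toListCochain_of_ne _ hl, toListCochain_of_ne _ (by simpa using hl), smul_zero]

variable [TopologicalSpace G] [TopologicalSpace V]

theorem continuousAt_toListCochain {n : ℕ} {f : Cochain G V n} {l : List G}
    (h : ∀ x, l = List.ofFn x → ContinuousAt f x) : ContinuousAt (toListCochain f) l := by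
  by_cases hl : l.length = n + 1
  · obtain ⟨x, hx⟩ := exists_eq_ofFn l
    generalize l.length = m at hl x hx
    subst hl hx
    refine ContinuousAt.congr (f := fun l => f (fun i => l.getD i 1))
      (continuousAt_comp _ (h x rfl) (continuous_pi fun i => continuous_getD 1 i)
        (by simp only [getD_ofFn])) ?_
    filter_upwards [eventually_length_eq (List.ofFn x)] with m hm
    rw [toListCochain, if_pos (by simpa using hm)]
  · refine ContinuousAt.congr (f := fun _ => 0) continuousAt_const ?_
    filter_upwards [eventually_length_eq l] with m hm
    rw [toListCochain_of_ne _ (hm ▸ hl)]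

variable [DistribMulAction G V] [IsTopologicalGroup G] [IsTopologicalAddGroup V]
  [ContinuousSMul G V]

/-- One covering set `W` containing 1 suffices: translation by `(x 0)⁻¹` moves a small tuple into
`W`, and equivariance carries continuity back. -/
theorem numerablyContinuous_toListCochain {n : ℕ} {f : Cochain G V n}
    (hf : f ∈ germCochains G V n) (hfe : f ∈ eqCochains G G V n) :
    NumerablyContinuous fun _ : List G => toListCochain f := by
  obtain ⟨𝔘, h𝔘, hc⟩ := hf
  obtain ⟨W, hW, h1W⟩ := Set.mem_sUnion.1 (h𝔘.2.symm ▸ Set.mem_univ (1 : G))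
  obtain ⟨δ, hδ, hδ0, hδn, hδt, hδW⟩ := exists_continuous_pseudometric ((h𝔘.1 W hW).mem_nhds h1W)
  refine ⟨fun _ => δ, ⟨hδ.comp continuous_snd, fun _ => hδ0, fun _ => hδn, fun _ => hδt⟩,
    fun y l hl => ?_⟩
  refine (continuousAt_comp (f := fun p : List G × List G => p.2) (y, l)
    (continuousAt_toListCochain (f := f) fun x hx => ?_) continuous_snd rfl :)
  subst hx
  have hx : (fun i => (x 0)⁻¹ * x i) ∈ diagNhd 𝔘 n := by
    simp only [diagNhd, Set.mem_iUnion, Set.mem_ofPred_eq]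
    have hmem : ∀ i, x i ∈ List.ofFn x := fun i => (List.mem_ofFn' x _).2 ⟨i, rfl⟩
    exact ⟨W, hW, fun i => hδW _ _ (hl _ (hmem 0) _ (hmem i))⟩
  have h1 := hc.continuousAt ((isOpen_diagNhd h𝔘 n).mem_nhds hx)
  have h2 : f = fun z => x 0 • f (fun i => (x 0)⁻¹ * z i) := by
    funext z
    have := hfe (x 0) fun i => (x 0)⁻¹ * z i
    simpa using this
  rw [h2]
  exact (continuousAt_comp (f := fun (z : Fin (n + 1) → G) i => (x 0)⁻¹ * z i) x h1
    (by fun_prop) rfl).const_smul (x 0)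

/-- The covering consists of all open sets whose tuples are continuity points; a neighbourhood of a
diagonal point contains the power of such a set. -/
theorem mem_germCochains_of_eventually {X : Type u} [TopologicalSpace X] {n : ℕ}
    {f : Cochain X V n} (h : ∀ x : X, ∀ᶠ z in 𝓝 (fun _ : Fin (n + 1) => x), ContinuousAt f z) :
    f ∈ germCochains X V n := by
  refine ⟨{U | IsOpen U ∧ ∀ z : Fin (n + 1) → X, (∀ i, z i ∈ U) → ContinuousAt f z},
    ⟨fun U hU => hU.1, Set.eq_univ_of_forall fun x => ?_⟩, fun z hz => ?_⟩
  · have h' := h x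
    rw [nhds_pi, Filter.eventually_iff, Filter.mem_pi] at h'
    obtain ⟨J, -, t, ht, htJ⟩ := h'
    refine Set.mem_sUnion.2 ⟨⋂ i, interior (t i), ⟨isOpen_iInter_of_finite fun i =>
      isOpen_interior, fun z hz => htJ fun i _ => interior_subset (Set.mem_iInter.1 (hz i) i)⟩,
      Set.mem_iInter.2 fun i => mem_interior_iff_mem_nhds.2 (ht i)⟩
  · simp only [diagNhd, Set.mem_iUnion] at hz
    obtain ⟨U, hU, hz⟩ := hz
    exact (hU.2 z hz).continuousWithinAt

variable [ContractibleSpace G]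

/-- A form of `exists_correction` for homogeneous cochains, covering all degrees. -/
theorem exists_listD_correction {n : ℕ} {f : Cochain G V n}
    (hf : f ∈ germCochains G V n) (hfe : f ∈ eqCochains G G V n)
    (hdf : d G V n f ∈ contCochains G V (n + 1)) :
    ∃ e : List G → V, (∀ (h : G) l, e (l.map (h * ·)) = h • e l) ∧
      (∀ (x : G) (n : ℕ), ∀ᶠ z in 𝓝 (fun _ : Fin n => x), ContinuousAt e (List.ofFn z)) ∧
      Continuous fun x : Fin (n + 1) → G => f x + listD e (List.ofFn x) := by
  obtain ⟨e, hee, heg, hec⟩ := exists_correction (numerablyContinuous_toListCochain hf hfe)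
    (toListCochain_equivariant hfe) (by
      rw [listD_toListCochain]
      have hdf' : Continuous (d G V n f) := hdf
      exact continuous_iff_continuousAt.2 fun l =>
        continuousAt_toListCochain fun x _ => hdf'.continuousAt) (n + 1)
  refine ⟨e, hee, heg, continuous_iff_continuousAt.2 fun x => ?_⟩
  have := continuousAt_comp (f := List.ofFn) x (hec (List.ofFn x) (by simp)) (continuous_ofFn _)
    rfl
  simpa only [toListCochain_ofFn] using this

/-- In degree 0 the correction is the augmentation of `e`, that is the constant `e []`. -/
theorem mem_contCochains_of_d_mem {f : Cochain G V 0} (hf : f ∈ germCochains G V 0)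
    (hfe : f ∈ eqCochains G G V 0) (hdf : d G V 0 f ∈ contCochains G V 1) :
    f ∈ contCochains G V 0 := by
  obtain ⟨e, -, -, h⟩ := exists_listD_correction hf hfe hdf
  have h' : Continuous fun x : Fin 1 → G => f x + e [] - e [] := by
    refine Continuous.sub ?_ continuous_const
    simpa [listD_cons] using h
  simp only [add_sub_cancel_right] at h'
  exact h'

theorem exists_add_d_mem_contCochains {n : ℕ} {f : Cochain G V (n + 1)}
    (hf : f ∈ germCochains G V (n + 1)) (hfe : f ∈ eqCochains G G V (n + 1))
    (hdf : d G V (n + 1) f ∈ contCochains G V (n + 2)) :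
    ∃ e ∈ germCochains G V n ⊓ eqCochains G G V n, f + d G V n e ∈ contCochains G V (n + 1) := by
  obtain ⟨e, hee, heg, h⟩ := exists_listD_correction hf hfe hdf
  refine ⟨fun x => e (List.ofFn x), ⟨mem_germCochains_of_eventually fun x => ?_, fun g x => ?_⟩, ?_⟩
  · filter_upwards [heg x (n + 1)] with z hz
    exact continuousAt_comp z hz (continuous_ofFn _) rfl
  · rw [← hee, List.map_ofFn]
    rfl
  · simp only [listD_ofFn] at h
    exact h

end Transfer

end EqCoh

namespace EqCoh

/-! ### A criterion for isomorphism in cohomology -/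

section Homology

variable {K L : CochainComplex AddCommGrpCat.{w} ℕ}

theorem exists_iCycles_eq (K : CochainComplex AddCommGrpCat.{w} ℕ) (n : ℕ) (x : K.X n)
    (hx : K.d n (n + 1) x = 0) : ∃ z : K.cycles n, K.iCycles n z = x :=
  (ShortComplex.ab_exact_iff _).1 (ShortComplex.exact_of_f_is_kernel
    (ShortComplex.mk (K.iCycles n) (K.d n (n + 1)) (K.iCycles_d n (n + 1)))
    (K.cyclesIsKernel n (n + 1) (by simp))) x hx

theorem exists_toCycles_eq (K : CochainComplex AddCommGrpCat.{w} ℕ) (m n : ℕ)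
    (hm : (ComplexShape.up ℕ).prev n = m) (z : K.cycles n) (hz : K.homologyπ n z = 0) :
    ∃ y : K.X m, K.toCycles m n y = z :=
  (ShortComplex.ab_exact_iff _).1 (ShortComplex.exact_of_g_is_cokernel
    (ShortComplex.mk (K.toCycles m n) (K.homologyπ n) (K.toCycles_comp_homologyπ m n))
    (K.homologyIsCokernel m n hm)) z hz

theorem iCycles_injective (K : CochainComplex AddCommGrpCat.{w} ℕ) (n : ℕ) :
    Function.Injective (K.iCycles n) :=
  (AddCommGrpCat.mono_iff_injective _).1 inferInstance

theorem iCycles_toCycles (K : CochainComplex AddCommGrpCat.{w} ℕ) (m n : ℕ) (y : K.X m) :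
    K.iCycles n (K.toCycles m n y) = K.d m n y := by
  rw [← ConcreteCategory.comp_apply, K.toCycles_i]

theorem d_iCycles (K : CochainComplex AddCommGrpCat.{w} ℕ) (m n : ℕ) (z : K.cycles m) :
    K.d m n (K.iCycles m z) = 0 := by
  rw [← ConcreteCategory.comp_apply, K.iCycles_d]
  rfl

theorem homologyπ_toCycles (K : CochainComplex AddCommGrpCat.{w} ℕ) (m n : ℕ) (y : K.X m) :
    K.homologyπ n (K.toCycles m n y) = 0 := by
  rw [← ConcreteCategory.comp_apply, K.toCycles_comp_homologyπ]
  rfl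

/-- An injective cochain map is a quasi-isomorphism if every cochain whose coboundary is in the
image is itself in the image up to a coboundary. -/
theorem isIso_homologyMap_of_exists (φ : K ⟶ L) (hinj : ∀ n, Function.Injective (φ.f n))
    (h0 : ∀ y : L.X 0, ∀ z : K.X 1, L.d 0 1 y = φ.f 1 z → ∃ x : K.X 0, y = φ.f 0 x)
    (hsucc : ∀ n, ∀ y : L.X (n + 1), ∀ z : K.X (n + 2), L.d (n + 1) (n + 2) y = φ.f (n + 2) z →
      ∃ (x : K.X (n + 1)) (w : L.X n), y = φ.f (n + 1) x + L.d n (n + 1) w) (n : ℕ) :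
    IsIso (HomologicalComplex.homologyMap φ n) := by
  have hcomm : ∀ m n (x : K.X m), φ.f n (K.d m n x) = L.d m n (φ.f m x) := fun m n x => by
    rw [← ConcreteCategory.comp_apply, ← ConcreteCategory.comp_apply, φ.comm]
  have hcyc : ∀ z : K.cycles n, L.iCycles n (HomologicalComplex.cyclesMap φ n z) =
      φ.f n (K.iCycles n z) := fun z => by
    rw [← ConcreteCategory.comp_apply, ← ConcreteCategory.comp_apply,
      HomologicalComplex.cyclesMap_i]
  have hπ : ∀ z : K.cycles n, HomologicalComplex.homologyMap φ n (K.homologyπ n z) =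
      L.homologyπ n (HomologicalComplex.cyclesMap φ n z) := fun z => by
    rw [← ConcreteCategory.comp_apply, ← ConcreteCategory.comp_apply,
      HomologicalComplex.homologyπ_naturality]
  have hsurjK : Function.Surjective (K.homologyπ n) :=
    (AddCommGrpCat.epi_iff_surjective _).1 inferInstance
  have hsurjL : Function.Surjective (L.homologyπ n) :=
    (AddCommGrpCat.epi_iff_surjective _).1 inferInstance
  have hmono : Mono (HomologicalComplex.homologyMap φ n) := by
    rw [AddCommGrpCat.mono_iff_injective, injective_iff_map_eq_zero]
    intro a ha
    obtain ⟨z, rfl⟩ := hsurjK a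
    rw [hπ] at ha
    cases n with
    | zero =>
      -- The predecessor of 0 is 0 by convention, and the differential from 0 to 0 vanishes.
      obtain ⟨y, hy⟩ := exists_toCycles_eq L 0 0 (by simp) _ ha
      have hz : φ.f 0 (K.iCycles 0 z) = 0 := by
        rw [← hcyc, ← hy, iCycles_toCycles, L.shape 0 0 (by simp)]
        rfl
      have hz' : K.iCycles 0 z = 0 := hinj 0 (by rw [hz, map_zero])
      have hz'' : z = 0 := iCycles_injective K 0 (by rw [hz', map_zero])
      rw [hz'', map_zero]
    | succ m =>
      obtain ⟨y, hy⟩ := exists_toCycles_eq L m (m + 1) (by simp) _ ha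
      have hz : L.d m (m + 1) y = φ.f (m + 1) (K.iCycles (m + 1) z) := by
        rw [← hcyc, ← hy, iCycles_toCycles]
      -- The bounding cochain `y` may be replaced by one from `K`, as changing it by a coboundary
      -- does not affect its differential.
      have key : ∃ x : K.X m, L.d m (m + 1) y = L.d m (m + 1) (φ.f m x) := by
        cases m with
        | zero =>
          obtain ⟨x, rfl⟩ := h0 y _ hz
          exact ⟨x, rfl⟩
        | succ m =>
          obtain ⟨x, w, rfl⟩ := hsucc m y _ hz
          refine ⟨x, ?_⟩
          rw [map_add, add_eq_left, ← ConcreteCategory.comp_apply, L.d_comp_d]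
          rfl
      obtain ⟨x, hx⟩ := key
      have hzx : K.toCycles m (m + 1) x = z := by
        apply iCycles_injective K
        apply hinj
        rw [iCycles_toCycles, hcomm, ← hx, hz]
      rw [← hzx, homologyπ_toCycles]
  have hepi : Epi (HomologicalComplex.homologyMap φ n) := by
    rw [AddCommGrpCat.epi_iff_surjective]
    intro a
    obtain ⟨z, rfl⟩ := hsurjL a
    have lift : ∀ x : K.X n, L.d n (n + 1) (φ.f n x) = 0 → ∃ z' : K.cycles n,
        L.iCycles n (HomologicalComplex.cyclesMap φ n z') = φ.f n x := fun x hx => by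
      obtain ⟨z', hz'⟩ := exists_iCycles_eq K n x (hinj _ (by rw [hcomm, hx, map_zero]))
      exact ⟨z', by rw [hcyc, hz']⟩
    have hz : L.d n (n + 1) (L.iCycles n z) = 0 := d_iCycles L n (n + 1) z
    cases n with
    | zero =>
      obtain ⟨x, hx⟩ := h0 (L.iCycles 0 z) 0 (by rw [hz, map_zero])
      obtain ⟨z', hz'⟩ := lift x (hx ▸ hz)
      exact ⟨K.homologyπ 0 z', by rw [hπ, iCycles_injective L 0 (hz'.trans hx.symm)]⟩
    | succ m =>
      obtain ⟨x, w, hx⟩ := hsucc m (L.iCycles (m + 1) z) 0 (by rw [hz, map_zero])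
      obtain ⟨z', hz'⟩ := lift x (by
        rw [← add_sub_cancel_right (φ.f (m + 1) x) (L.d m (m + 1) w), ← hx, map_sub, hz,
          ← ConcreteCategory.comp_apply, L.d_comp_d]
        exact sub_self 0)
      refine ⟨K.homologyπ (m + 1) z', ?_⟩
      have e : z = HomologicalComplex.cyclesMap φ (m + 1) z' + L.toCycles m (m + 1) w := by
        apply iCycles_injective L
        rw [map_add, hz', iCycles_toCycles, hx]
      rw [hπ, e, map_add, homologyπ_toCycles, add_zero]
  exact isIso_of_mono_of_epi _

end Homology

end EqCoh

theorem mainTheorem2 {G : Type u} [Group G] [TopologicalSpace G] [IsTopologicalGroup G]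
    [ContractibleSpace G]
    {V : Type v} [AddCommGroup V] [TopologicalSpace V] [IsTopologicalAddGroup V]
    [DistribMulAction G V] [ContinuousSMul G V] (n : ℕ) :
    IsIso (HomologicalComplex.homologyMap (EqCoh.contToGerm G G V) n) := by
  have hdc : ∀ (n : ℕ) (y : (EqCoh.germComplex G G V).X n),
      (((EqCoh.germComplex G G V).d n (n + 1) y).1 : EqCoh.Cochain G V (n + 1)) =
        EqCoh.d G V n y.1 := fun n y => by
    simp only [EqCoh.germComplex, EqCoh.subcomplex, CochainComplex.of_d]
    rfl
  refine EqCoh.isIso_homologyMap_of_exists _ (fun n x y hxy => ?_) (fun y z hyz => ?_)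
    (fun n y z hyz => ?_) n
  · have h : x.1 = y.1 := congrArg (fun z : (EqCoh.germComplex G G V).X n => z.1) hxy
    exact Subtype.ext h
  · have h : EqCoh.d G V 0 y.1 = z.1 := (hdc 0 y).symm.trans (congrArg Subtype.val hyz)
    exact ⟨⟨y.1, EqCoh.mem_contCochains_of_d_mem y.2.1 y.2.2 (h ▸ z.2.1), y.2.2⟩, rfl⟩
  · have h : EqCoh.d G V (n + 1) y.1 = z.1 := (hdc (n + 1) y).symm.trans (congrArg Subtype.val hyz)
    obtain ⟨e, he, hc⟩ := EqCoh.exists_add_d_mem_contCochains y.2.1 y.2.2 (h ▸ z.2.1)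
    refine ⟨⟨y.1 + EqCoh.d G V n e, hc, add_mem y.2.2 (EqCoh.d_mem_eqCochains n e he.2)⟩,
      ⟨-e, neg_mem he⟩, Subtype.ext ?_⟩
    have h' : y.1 = y.1 + EqCoh.d G V n e + EqCoh.d G V n (-e) := by
      rw [map_neg, add_neg_cancel_right]
    exact h'.trans (congrArg (y.1 + EqCoh.d G V n e + ·) (hdc n ⟨-e, neg_mem he⟩).symm)
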